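/- **Data.** Let $T,L,\ell,s_0$ be integers (horizon, min-up time, min-down time, initial on-time of a generator that is on before period 1) with $L,\ell\ge 1$, $s_0\ge 0$, and put $t_0=\max\{L-s_0,0\}$. Let $\underline C,V,\overline V\ge 0$ and $\overline C\in\mathbb R$ (generation bounds $\underline C,\overline C$, ramp rate $V$, start-up/shut-down ramp rate $\overline V$). Let $S(n)\ge 0$ $(n\ge\ell)$ be the start-up cost after $n$ off-periods, nondecreasing in $n$, and $S'(n)\ge0$ $(n\ge L)$ the shut-down cost after $n$ on-periods. Let $N\ge1$, $a^s_j,b^s_j\in\mathbb R$ and $f_s(x,u)=\max_{1\le j\le N}(a_j^s x+b_j^s u)$. Write $[a,b]$ for the set of integers $i$ with $a\le i\le b$. Assume that the horizon is compatible with the min-down and min-up constraints below: ($t_0+\ell\le T$ or $T\le t_0+1$) and ($t_0+\ell+L\le T$ or $T\le t_0+\ell+1$). **2-Bin model (UC).** Variables $x_t,u_t$ $(t\in[0,T])$, $v_t$ $(t\in[1,T])$, $\zeta_t$ $(t\in[t_0+\ell+1,T])$, $\zeta'_t$ $(t\in[t_0,T-1])$. Minimize $\sum_{t=1}^T f_t(x_t,u_t)+\sum_{t=t_0+\ell+1}^T\zeta_t+\sum_{t=t_0}^{T-1}\zeta'_t$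 subject to - $u_0=1$; $u_t=1$ for $t\in[1,t_0]$; $u_t,v_t\in\{0,1\}$ for $t\in[1,T]$; $\zeta,\zeta'\ge0$; - $\sum_{i=t-L+1}^t v_i\le u_t$ for $t\in[t_0+\ell+L,T]$; $\sum_{i=t-\ell+1}^t v_i\le 1-u_{t-\ell}$ for $t\in[t_0+\ell,T]$; - for $t\in[1,T]$: $u_t-u_{t-1}\le v_t$, $\underline C u_t\le x_t\le\overline C u_t$, $x_t-x_{t-1}\le Vu_{t-1}+\overline V(1-u_{t-1})$, $x_{t-1}-x_t\le Vu_t+\overline V(1-u_t)$; - $\zeta'_t\ge S'(t+s_0)\bigl(1-u_{t+1}-\sum_{s=1}^t(1-u_s)\bigr)$ for $t\in[t_0,T-1]$; - $\zeta'_t\ge S'(t-k+1)\bigl(v_k-\sum_{s=k}^t(1-u_s)-u_{t+1}\bigr)$ for $t\in[t_0+\ell+L,T-1]$, $k\in[t_0+\ell+1,t-L+1]$; - $\zeta_t\ge S(t-k-1)\bigl(v_t-\sum_{s=k+1}^{t-1}u_s\bigr)$ for $t\in[t_0+\ell+1,T]$, $k\in[t_0,t-\ell-1]$. The initial output $x_0$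 is an otherwise unrestricted variable. **Extended model (EUC).** Let $\mathcal{TK}^1=\{(1,k):k\in[\max\{t_0,1\},T]\}$, $\mathcal{TK}^2=\{(t,k):t\in[t_0+\ell+1,T],\,k\in[\min\{t+L-1,T\},T]\}$, $\mathcal{TK}=\mathcal{TK}^1\cup\mathcal{TK}^2$, $\mathcal{KT}=\{(k,t):k\in[t_0,T-\ell-1],\,t\in[k+\ell+1,T]\}$. Variables are $w_t$ $(t\in[t_0,T])$, $y_{tk}$ $(tk\in\mathcal{TK}^2)$, $z_{kt}$ $(kt\in\mathcal{KT})$, $\theta_t$ $(t\in[t_0,T-1])$, and $q^s_{tk},\phi^s_{tk}$ $(tk\in\mathcal{TK},\,s\in[t,k])$; put $p_{tk}=w_k$ for $tk\in\mathcal{TK}^1$ and $p_{tk}=y_{tk}$ for $tk\in\mathcal{TK}^2$. EUC is the linear program: minimize $$\sum_{t=t_0}^{T-1}S'(t+s_0)w_t+\sum_{t=t_0+\ell+1}^{T-L}\sum_{k=t+L-1}^{T-1}S'(k-t+1)y_{tk}+\sum_{kt\in\mathcal{KT}}S(t-k-1)z_{kt}+\sum_{tk\in\mathcal{TK}}\sum_{s=t}^k\phi^s_{tk}$$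 subject to - $\sum_{t=t_0}^Tw_t=1$; - $-w_t+\sum_{k=t+\ell+1}^Tz_{tk}-\sum_{k=t_0+\ell+1}^{t-L+1}y_{kt}+\theta_t=0$ for $t\in[t_0,T-1]$; - $\sum_{k=\min\{t+L-1,T\}}^Ty_{tk}-\sum_{k=t_0}^{t-\ell-1}z_{kt}=0$ for $t\in[t_0+\ell+1,T]$; - for $tk\in\mathcal{TK}$: $\underline Cp_{tk}\le q^s_{tk}\le\overline Cp_{tk}$ and $\phi^s_{tk}-a^s_jq^s_{tk}\ge b^s_jp_{tk}$ for $s\in[t,k]$, $j\in[1,N]$; $|q^{s}_{tk}-q^{s-1}_{tk}|\le Vp_{tk}$ for $s\in[t+1,k]$; $q^k_{tk}\le\overline Vp_{tk}$ if $k\le T-1$; and $q^t_{tk}\le\overline Vp_{tk}$ if $tk\in\mathcal{TK}^2$; - $w,y,z\ge0$, and $\theta_t\ge0$ for $t\in[t_0,T-\ell-1]$. **Proposition 2.** Let $(w^*,y^*,z^*,\theta^*,q^*,\phi^*)$ be an optimal solution of the linear program EUC in which all $w^*_t,y^*_{tk},z^*_{kt}$ are $0$ or $1$. For $s\in[1,T]$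 set $$x^*_s=\sum_{tk\in\mathcal{TK},\,t\le s\le k}q^{s*}_{tk},\qquad u^*_s=\sum_{tk\in\mathcal{TK}^1,\,k\ge s}w^*_k+\sum_{tk\in\mathcal{TK}^2,\,t\le s\le k}y^*_{tk},\qquad v^*_s=\sum_{kt\in\mathcal{KT},\,t=s}z^*_{kt}.$$ Then $(x^*,u^*,v^*)$ is an optimal solution of UC, that is, with $u_0=1$ and suitable values of the auxiliary variables $x_0,\zeta,\zeta'$ it is feasible for UC and attains the minimum of its objective. -/

import Mathlib

open Finset

noncomputable section

namespace UnitCommitment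

/-- Data of the single-generator problem: horizon `T`, min-up time `L`, min-down time `ℓ`,
initial on-time `s₀`, generation bounds `Cmin`, `Cmax`, start-up/shut-down ramp rate `Vbar`,
stable ramp rate `V`, start-up cost `S n` (after `n` off periods), shut-down cost `S' n`
(after `n` on periods), and slopes `a j s`, intercepts `b j s` of the `N` linear pieces of the
net cost at time `s`. -/
structure Data where
  T : ℤ
  L : ℤ
  ℓ : ℤ
  s₀ : ℤ
  Cmin : ℝ
  Cmax : ℝ
  Vbar : ℝ
  V : ℝ
  S : ℤ → ℝ
  S' : ℤ → ℝ
  N : ℕ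
  a : Fin N → ℤ → ℝ
  b : Fin N → ℤ → ℝ

namespace Data

variable (D : Data)

/-- `t₀ = [L - s₀]⁺`: the generator cannot shut down before time `t₀ + 1`. -/
def t₀ : ℤ := max (D.L - D.s₀) 0

/-- Piecewise linear net cost `f_t(x, u) = max_j (a_j^t x + b_j^t u)`. -/
def f (t : ℤ) (x u : ℝ) : ℝ := ⨆ j : Fin D.N, (D.a j t * x + D.b j t * u)

end Data

/-! ### The 2-Bin formulation -/

/-- Decision variables. Only the entries at the indices that occur in the model matter:
`x_t`, `u_t` for `0 ≤ t ≤ T`, `v_t` for `1 ≤ t ≤ T`, `ζ_t` for `t₀ + ℓ + 1 ≤ t ≤ T`, and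
`ζ'_t` for `t₀ ≤ t ≤ T - 1`. -/
structure UCVars where
  x : ℤ → ℝ
  u : ℤ → ℝ
  v : ℤ → ℝ
  ζ : ℤ → ℝ
  ζ' : ℤ → ℝ

def UCObj (D : Data) (p : UCVars) : ℝ :=
  ∑ t ∈ Icc 1 D.T, D.f t (p.x t) (p.u t)
    + ∑ t ∈ Icc (D.t₀ + D.ℓ + 1) D.T, p.ζ t
    + ∑ t ∈ Icc D.t₀ (D.T - 1), p.ζ' t

structure UCFeasible (D : Data) (p : UCVars) : Prop where
  init_on : ∀ t ∈ Icc 1 D.t₀, p.u t = 1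
  min_up : ∀ t ∈ Icc (D.t₀ + D.ℓ + D.L) D.T, ∑ i ∈ Icc (t - D.L + 1) t, p.v i ≤ p.u t
  min_down : ∀ t ∈ Icc (D.t₀ + D.ℓ) D.T,
    ∑ i ∈ Icc (t - D.ℓ + 1) t, p.v i ≤ 1 - p.u (t - D.ℓ)
  logic : ∀ t ∈ Icc 1 D.T, p.u t - p.u (t - 1) - p.v t ≤ 0
  lower : ∀ t ∈ Icc 1 D.T, -p.x t + D.Cmin * p.u t ≤ 0
  upper : ∀ t ∈ Icc 1 D.T, p.x t - D.Cmax * p.u t ≤ 0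
  ramp_up : ∀ t ∈ Icc 1 D.T,
    p.x t - p.x (t - 1) ≤ D.V * p.u (t - 1) + D.Vbar * (1 - p.u (t - 1))
  ramp_down : ∀ t ∈ Icc 1 D.T,
    p.x (t - 1) - p.x t ≤ D.V * p.u t + D.Vbar * (1 - p.u t)
  /-- Cost of the first shut-down, at time `t + 1`. -/
  shut_first : ∀ t ∈ Icc D.t₀ (D.T - 1),
    D.S' (t + D.s₀) * (1 - p.u (t + 1) - ∑ s ∈ Icc 1 t, (1 - p.u s)) ≤ p.ζ' t
  /-- Cost of a shut-down at time `t + 1` after a start-up at time `k`. -/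
  shut_later : ∀ t ∈ Icc (D.t₀ + D.ℓ + D.L) (D.T - 1),
    ∀ k ∈ Icc (D.t₀ + D.ℓ + 1) (t - D.L + 1),
      D.S' (t - k + 1) * (p.v k - ∑ s ∈ Icc k t, (1 - p.u s) - p.u (t + 1)) ≤ p.ζ' t
  /-- Cost of a start-up at time `t` after a shut-down at time `k + 1`. -/
  start : ∀ t ∈ Icc (D.t₀ + D.ℓ + 1) D.T, ∀ k ∈ Icc D.t₀ (t - D.ℓ - 1),
    D.S (t - k - 1) * (p.v t - ∑ s ∈ Icc (k + 1) (t - 1), p.u s) ≤ p.ζ t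
  u_binary : ∀ t ∈ Icc 1 D.T, p.u t = 0 ∨ p.u t = 1
  v_binary : ∀ t ∈ Icc 1 D.T, p.v t = 0 ∨ p.v t = 1
  ζ_nonneg : ∀ t ∈ Icc (D.t₀ + D.ℓ + 1) D.T, 0 ≤ p.ζ t
  ζ'_nonneg : ∀ t ∈ Icc D.t₀ (D.T - 1), 0 ≤ p.ζ' t
  u_zero : p.u 0 = 1

def UCOptimal (D : Data) (p : UCVars) : Prop :=
  UCFeasible D p ∧ ∀ p', UCFeasible D p' → UCObj D p ≤ UCObj D p'

/-! ### The extended formulation EUC -/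

/-- Initial on-intervals `[1, k]`: the nonempty ones among those with `t₀ ≤ k ≤ T`. -/
def TK1 (D : Data) : Finset (ℤ × ℤ) := {1} ×ˢ Icc (max D.t₀ 1) D.T

/-- Later on-intervals `[t, k]`, `t₀ + ℓ + 1 ≤ t ≤ T`, `min (t + L - 1) T ≤ k ≤ T`. -/
def TK2 (D : Data) : Finset (ℤ × ℤ) :=
  (Icc (D.t₀ + D.ℓ + 1) D.T ×ˢ Icc (D.t₀ + D.ℓ + 1) D.T).filter
    fun i => min (i.1 + D.L - 1) D.T ≤ i.2

def TK (D : Data) : Finset (ℤ × ℤ) := TK1 D ∪ TK2 D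

/-- Pairs `(k, t)` with `t₀ ≤ k ≤ T - ℓ - 1` and `k + ℓ + 1 ≤ t ≤ T`: shut-down at time `k + 1`,
next start-up at time `t`. -/
def KT (D : Data) : Finset (ℤ × ℤ) :=
  (Icc D.t₀ (D.T - D.ℓ - 1) ×ˢ Icc D.t₀ D.T).filter fun i => i.1 + D.ℓ + 1 ≤ i.2

/-- Decision variables; `q t k s` and `φ t k s` stand for `q_{tk}^s` and `φ_{tk}^s`. Only the
entries at the indices that occur in the model matter. -/
structure EUCVars where
  w : ℤ → ℝ
  y : ℤ → ℤ → ℝ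
  z : ℤ → ℤ → ℝ
  θ : ℤ → ℝ
  q : ℤ → ℤ → ℤ → ℝ
  φ : ℤ → ℤ → ℤ → ℝ

def EUCObj (D : Data) (e : EUCVars) : ℝ :=
  ∑ t ∈ Icc D.t₀ (D.T - 1), D.S' (t + D.s₀) * e.w t
    + ∑ t ∈ Icc (D.t₀ + D.ℓ + 1) (D.T - D.L), ∑ k ∈ Icc (t + D.L - 1) (D.T - 1),
        D.S' (k - t + 1) * e.y t k
    + ∑ i ∈ KT D, D.S (i.2 - i.1 - 1) * e.z i.1 i.2
    + ∑ i ∈ TK D, ∑ s ∈ Icc i.1 i.2, e.φ i.1 i.2 s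

/-- The constraints of the linear program EUC. -/
structure EUCFeasible (D : Data) (e : EUCVars) : Prop where
  sum_w : ∑ t ∈ Icc D.t₀ D.T, e.w t = 1
  flow_down : ∀ t ∈ Icc D.t₀ (D.T - 1),
    -e.w t + ∑ k ∈ Icc (t + D.ℓ + 1) D.T, e.z t k
      - ∑ k ∈ Icc (D.t₀ + D.ℓ + 1) (t - D.L + 1), e.y k t + e.θ t = 0
  flow_up : ∀ t ∈ Icc (D.t₀ + D.ℓ + 1) D.T,
    ∑ k ∈ Icc (min (t + D.L - 1) D.T) D.T, e.y t k
      - ∑ k ∈ Icc D.t₀ (t - D.ℓ - 1), e.z k t = 0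
  bounds1 : ∀ t k, (t, k) ∈ TK1 D → ∀ s ∈ Icc t k,
    D.Cmin * e.w k ≤ e.q t k s ∧ e.q t k s ≤ D.Cmax * e.w k
  bounds2 : ∀ t k, (t, k) ∈ TK2 D → ∀ s ∈ Icc t k,
    D.Cmin * e.y t k ≤ e.q t k s ∧ e.q t k s ≤ D.Cmax * e.y t k
  start_ramp : ∀ t k, (t, k) ∈ TK2 D → e.q t k t ≤ D.Vbar * e.y t k
  shut_ramp1 : ∀ t k, (t, k) ∈ TK1 D → k ≤ D.T - 1 → e.q t k k ≤ D.Vbar * e.w k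
  shut_ramp2 : ∀ t k, (t, k) ∈ TK2 D → k ≤ D.T - 1 → e.q t k k ≤ D.Vbar * e.y t k
  ramp1 : ∀ t k, (t, k) ∈ TK1 D → ∀ s ∈ Icc (t + 1) k,
    e.q t k (s - 1) - e.q t k s ≤ D.V * e.w k ∧ e.q t k s - e.q t k (s - 1) ≤ D.V * e.w k
  ramp2 : ∀ t k, (t, k) ∈ TK2 D → ∀ s ∈ Icc (t + 1) k,
    e.q t k (s - 1) - e.q t k s ≤ D.V * e.y t k ∧ e.q t k s - e.q t k (s - 1) ≤ D.V * e.y t k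
  cost1 : ∀ t k, (t, k) ∈ TK1 D → ∀ s ∈ Icc t k, ∀ j : Fin D.N,
    D.b j s * e.w k ≤ e.φ t k s - D.a j s * e.q t k s
  cost2 : ∀ t k, (t, k) ∈ TK2 D → ∀ s ∈ Icc t k, ∀ j : Fin D.N,
    D.b j s * e.y t k ≤ e.φ t k s - D.a j s * e.q t k s
  w_nonneg : ∀ t ∈ Icc D.t₀ D.T, 0 ≤ e.w t
  y_nonneg : ∀ t k, (t, k) ∈ TK2 D → 0 ≤ e.y t k
  z_nonneg : ∀ k t, (k, t) ∈ KT D → 0 ≤ e.z k t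
  θ_nonneg : ∀ t ∈ Icc D.t₀ (D.T - D.ℓ - 1), 0 ≤ e.θ t

/-- Optimality in the linear program EUC (no integrality is imposed on the competitors). -/
def EUCOptimal (D : Data) (e : EUCVars) : Prop :=
  EUCFeasible D e ∧ ∀ e', EUCFeasible D e' → EUCObj D e ≤ EUCObj D e'

/-- `w`, `y`, `z` are binary; `θ` is then an integer by the flow constraints. -/
structure EUCIntegral (D : Data) (e : EUCVars) : Prop where
  w : ∀ t ∈ Icc D.t₀ D.T, e.w t = 0 ∨ e.w t = 1
  y : ∀ t k, (t, k) ∈ TK2 D → e.y t k = 0 ∨ e.y t k = 1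
  z : ∀ k t, (k, t) ∈ KT D → e.z k t = 0 ∨ e.z k t = 1

/-! ### The induced 2-Bin schedule -/

def xOf (D : Data) (e : EUCVars) (s : ℤ) : ℝ :=
  ∑ i ∈ (TK D).filter (fun i => i.1 ≤ s ∧ s ≤ i.2), e.q i.1 i.2 s

def uOf (D : Data) (e : EUCVars) (s : ℤ) : ℝ :=
  ∑ i ∈ (TK1 D).filter (fun i => s ≤ i.2), e.w i.2
    + ∑ i ∈ (TK2 D).filter (fun i => i.1 ≤ s ∧ s ≤ i.2), e.y i.1 i.2

def vOf (D : Data) (e : EUCVars) (s : ℤ) : ℝ :=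
  ∑ i ∈ (KT D).filter (fun i => i.2 = s), e.z i.1 i.2

end UnitCommitment

end

noncomputable section

namespace UnitCommitment

variable {D : Data} {e : EUCVars}

/-! EUC routes one unit of flow through a network whose arcs are maximal on-intervals and
off-intervals; `θ` is the flow that leaves after a shut-down and stays off until the horizon. The
proof builds a translation in each direction that does not raise the objective. For the given
optimal `e` and any UC-feasible `p`, this gives `UCObj (toUC e) ≤ EUCObj e ≤ EUCObj (toEUC p) ≤
UCObj p`, the middle step being optimality of `e` in the linear program.

From EUC to UC, everything rests on the conservation law `onFlow_add_offFlow`: on-flow plus off-flow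
is one at every time from `t₀` to `T`. The min-up and min-down constraints then hold because the
intervals with a recent start-up all cover one common time, on or off, and cannot carry more than
the flow there. Ramps and generation costs are added up interval by interval. Integrality gives a
binary `u` and `v`, and it lets each cost bracket be read off from the single active interval
(`shut_first_bracket_le`, `shut_later_bracket_le`, `start_le`). The last of these needs `S` to be
nondecreasing.

From UC to EUC, a binary schedule is cut into its maximal runs, whose indicators are `w`, `y`, `z`.
The horizon-compatibility hypotheses ensure that the 2-Bin constraints really force minimal run
lengths (`off_before_startUp`, `on_after_startUp`), so each run is an arc of the network. Each run
makes the corresponding UC cost bracket equal to one, so its cost is already paid by `ζ` or `ζ'`. -/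

/-! ### Flows through the interval network -/

/-- Flow through the on-intervals that cover time `s`, where the initial on-interval is taken
to extend to the past. -/
def onFlow (D : Data) (e : EUCVars) (s : ℤ) : ℝ :=
  ∑ k ∈ (Icc D.t₀ D.T).filter (fun k => s ≤ k), e.w k
    + ∑ i ∈ (TK2 D).filter (fun i => i.1 ≤ s ∧ s ≤ i.2), e.y i.1 i.2

/-- Flow through the off-intervals that cover time `s`, or that has left the network before. -/
def offFlow (D : Data) (e : EUCVars) (s : ℤ) : ℝ :=
  ∑ i ∈ (KT D).filter (fun i => i.1 < s ∧ s < i.2), e.z i.1 i.2 + ∑ t ∈ Icc D.t₀ (s - 1), e.θ t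

def startFlow (D : Data) (e : EUCVars) (s : ℤ) : ℝ :=
  ∑ i ∈ (TK2 D).filter (fun i => i.1 = s), e.y i.1 i.2

def endFlow (D : Data) (e : EUCVars) (s : ℤ) : ℝ :=
  ∑ k ∈ (Icc D.t₀ D.T).filter (fun k => k = s), e.w k
    + ∑ i ∈ (TK2 D).filter (fun i => i.2 = s), e.y i.1 i.2

def leaveFlow (D : Data) (e : EUCVars) (s : ℤ) : ℝ :=
  ∑ i ∈ (KT D).filter (fun i => i.1 = s), e.z i.1 i.2

/-- Cost charged for a shut-down at time `t + 1`. -/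
def shutCost (D : Data) (e : EUCVars) (t : ℤ) : ℝ :=
  D.S' (t + D.s₀) * e.w t
    + ∑ k ∈ Icc (D.t₀ + D.ℓ + 1) (t - D.L + 1), D.S' (t - k + 1) * e.y k t

/-- Cost charged for a start-up at time `t`. -/
def startCost (D : Data) (e : EUCVars) (t : ℤ) : ℝ :=
  ∑ k ∈ Icc D.t₀ (t - D.ℓ - 1), D.S (t - k - 1) * e.z k t

/-- The weight `p_{tk}` of an on-interval. -/
def weight (D : Data) (e : EUCVars) (i : ℤ × ℤ) : ℝ :=
  if i ∈ TK1 D then e.w i.2 else e.y i.1 i.2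

theorem t₀_nonneg (D : Data) : 0 ≤ D.t₀ := le_max_right _ _

theorem le_t₀_add (D : Data) : D.L ≤ D.t₀ + D.s₀ := by
  have := le_max_left (D.L - D.s₀) 0
  unfold Data.t₀; omega

theorem mem_TK1 {i : ℤ × ℤ} : i ∈ TK1 D ↔ i.1 = 1 ∧ D.t₀ ≤ i.2 ∧ 1 ≤ i.2 ∧ i.2 ≤ D.T := by
  rw [TK1, mem_product, mem_singleton, mem_Icc]; omega

theorem mem_TK2 (hL : 1 ≤ D.L) {i : ℤ × ℤ} :
    i ∈ TK2 D ↔ D.t₀ + D.ℓ + 1 ≤ i.1 ∧ i.1 ≤ i.2 ∧ i.2 ≤ D.T ∧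
      (i.1 + D.L - 1 ≤ i.2 ∨ i.2 = D.T) := by
  simp only [TK2, mem_filter, mem_product, mem_Icc]; omega

theorem mem_KT (hℓ : 1 ≤ D.ℓ) {i : ℤ × ℤ} :
    i ∈ KT D ↔ D.t₀ ≤ i.1 ∧ i.1 + D.ℓ + 1 ≤ i.2 ∧ i.2 ≤ D.T := by
  simp only [KT, mem_filter, mem_product, mem_Icc]; omega

theorem notMem_TK1_of_mem_TK2 (hL : 1 ≤ D.L) (hℓ : 1 ≤ D.ℓ) {i : ℤ × ℤ} (hi : i ∈ TK2 D) :
    i ∉ TK1 D := by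
  have := t₀_nonneg D
  rw [mem_TK2 hL] at hi
  rw [mem_TK1]; omega

theorem sum_TK (hL : 1 ≤ D.L) (hℓ : 1 ≤ D.ℓ) (g : ℤ × ℤ → ℝ) :
    ∑ i ∈ TK D, g i = ∑ k ∈ Icc (max D.t₀ 1) D.T, g (1, k) + ∑ i ∈ TK2 D, g i := by
  rw [TK, sum_union, TK1, sum_product]
  · simp
  · exact disjoint_right.2 fun i hi => notMem_TK1_of_mem_TK2 hL hℓ hi

theorem weight_of_mem_TK1 {i : ℤ × ℤ} (hi : i ∈ TK1 D) : weight D e i = e.w i.2 := if_pos hi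

theorem weight_of_mem_TK2 (hL : 1 ≤ D.L) (hℓ : 1 ≤ D.ℓ) {i : ℤ × ℤ} (hi : i ∈ TK2 D) :
    weight D e i = e.y i.1 i.2 := if_neg (notMem_TK1_of_mem_TK2 hL hℓ hi)

/-- A sum of weights over on-intervals, split into initial and later intervals. -/
theorem sum_TK_weight (hL : 1 ≤ D.L) (hℓ : 1 ≤ D.ℓ) (P : ℤ × ℤ → Prop) [DecidablePred P]
    (hP : ∀ k, P (1, k) → 1 ≤ k) :
    ∑ i ∈ (TK D).filter P, weight D e i
      = ∑ k ∈ (Icc D.t₀ D.T).filter (fun k => P (1, k)), e.w k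
        + ∑ i ∈ (TK2 D).filter P, e.y i.1 i.2 := by
  rw [sum_filter, sum_TK hL hℓ, ← sum_filter, ← sum_filter]
  congr 1
  -- If `t₀ = 0`, the index `k = 0` is an empty initial interval outside `TK1`; `hP` keeps it out of
  -- the sum.
  · have : (Icc (max D.t₀ 1) D.T).filter (fun k => P (1, k))
        = (Icc D.t₀ D.T).filter (fun k => P (1, k)) := by
      ext k
      have := hP k
      simp only [mem_filter, mem_Icc]
      grind
    rw [this]
    refine sum_congr rfl fun k hk => ?_
    have := hP k
    refine weight_of_mem_TK1 (i := (1, k)) (mem_TK1.2 ?_)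
    simp only [mem_filter, mem_Icc] at hk
    grind
  · exact sum_congr rfl fun i hi => weight_of_mem_TK2 hL hℓ (mem_filter.1 hi).1

theorem onFlow_eq_sum_weight (hL : 1 ≤ D.L) (hℓ : 1 ≤ D.ℓ) {s : ℤ} (hs : 1 ≤ s) :
    onFlow D e s = ∑ i ∈ (TK D).filter (fun i => i.1 ≤ s ∧ s ≤ i.2), weight D e i := by
  rw [sum_TK_weight hL hℓ _ (fun k hk => by simp only at hk; omega), onFlow]
  simp [hs]

theorem endFlow_eq_sum_weight (hL : 1 ≤ D.L) (hℓ : 1 ≤ D.ℓ) {s : ℤ} (hs : 1 ≤ s) :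
    endFlow D e s = ∑ i ∈ (TK D).filter (fun i => i.2 = s), weight D e i := by
  rw [sum_TK_weight hL hℓ _ (fun k hk => by simp only at hk; omega), endFlow]

theorem startFlow_eq_sum_weight (hL : 1 ≤ D.L) (hℓ : 1 ≤ D.ℓ) {s : ℤ} (hs : 2 ≤ s) :
    startFlow D e s = ∑ i ∈ (TK D).filter (fun i => i.1 = s), weight D e i := by
  rw [sum_TK_weight hL hℓ _ (fun k hk => by simp only at hk; omega), startFlow,
    filter_false_of_mem (s := Icc D.t₀ D.T) (fun k _ => by simp only; omega)]
  simp

theorem onFlow_eq_uOf {s : ℤ} (hs : 1 ≤ s) : onFlow D e s = uOf D e s := by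
  rw [onFlow, uOf, TK1, sum_filter, sum_filter (s := _ ×ˢ _), sum_product, sum_singleton,
    ← sum_filter, ← sum_filter]
  congr 2
  ext k
  simp only [mem_filter, mem_Icc]; omega

/-- Intervals covering `s` or starting at `s + 1` are exactly those covering `s + 1` or ending at
`s`. Initial intervals extend to the past, so they never start. -/
theorem onFlow_succ (hL : 1 ≤ D.L) {s : ℤ} :
    onFlow D e (s + 1) = onFlow D e s + startFlow D e (s + 1) - endFlow D e s := by
  have h1 : ∑ k ∈ (Icc D.t₀ D.T).filter (fun k => s ≤ k), e.w k
      = ∑ k ∈ (Icc D.t₀ D.T).filter (fun k => s + 1 ≤ k), e.w k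
        + ∑ k ∈ (Icc D.t₀ D.T).filter (fun k => k = s), e.w k := by
    simp only [sum_filter, ← sum_add_distrib]
    refine sum_congr rfl fun k _ => ?_
    split_ifs <;> first | omega | simp
  have h2 : ∑ i ∈ (TK2 D).filter (fun i => i.1 ≤ s ∧ s ≤ i.2), e.y i.1 i.2
      + ∑ i ∈ (TK2 D).filter (fun i => i.1 = s + 1), e.y i.1 i.2
      = ∑ i ∈ (TK2 D).filter (fun i => i.1 ≤ s + 1 ∧ s + 1 ≤ i.2), e.y i.1 i.2
        + ∑ i ∈ (TK2 D).filter (fun i => i.2 = s), e.y i.1 i.2 := by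
    simp only [sum_filter, ← sum_add_distrib]
    refine sum_congr rfl fun i hi => ?_
    rw [mem_TK2 hL] at hi
    split_ifs <;> first | omega | simp
  unfold onFlow startFlow endFlow
  linarith

/-- Since `ℓ ≥ 1`, an off-interval leaving at `s` still covers `s + 1`. Flow sent to `θ` never
returns, so it accumulates. -/
theorem offFlow_succ (hℓ : 1 ≤ D.ℓ) {s : ℤ} (hs : D.t₀ ≤ s) :
    offFlow D e (s + 1) = offFlow D e s + leaveFlow D e s + e.θ s - vOf D e (s + 1) := by
  have h1 : ∑ i ∈ (KT D).filter (fun i => i.1 < s ∧ s < i.2), e.z i.1 i.2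
      + ∑ i ∈ (KT D).filter (fun i => i.1 = s), e.z i.1 i.2
      = ∑ i ∈ (KT D).filter (fun i => i.1 < s + 1 ∧ s + 1 < i.2), e.z i.1 i.2
        + ∑ i ∈ (KT D).filter (fun i => i.2 = s + 1), e.z i.1 i.2 := by
    simp only [sum_filter, ← sum_add_distrib]
    refine sum_congr rfl fun i hi => ?_
    rw [mem_KT hℓ] at hi
    split_ifs <;> first | omega | simp
  have h2 : ∑ t ∈ Icc D.t₀ (s + 1 - 1), e.θ t = ∑ t ∈ Icc D.t₀ (s - 1), e.θ t + e.θ s := by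
    have : Icc D.t₀ (s + 1 - 1) = insert s (Icc D.t₀ (s - 1)) := by
      ext t; simp only [mem_insert, mem_Icc]; omega
    rw [this, sum_insert (by simp), add_comm]
  unfold offFlow leaveFlow vOf
  linarith

/-! ### Flows as the sums in the EUC constraints -/

theorem endFlow_eq (hL : 1 ≤ D.L) {t : ℤ} (ht : t ∈ Icc D.t₀ (D.T - 1)) :
    endFlow D e t
      = e.w t + ∑ k ∈ Icc (D.t₀ + D.ℓ + 1) (t - D.L + 1), e.y k t := by
  rw [mem_Icc] at ht
  unfold endFlow
  congr 1
  · rw [sum_filter, sum_ite_eq' (Icc D.t₀ D.T), if_pos (by rw [mem_Icc]; omega)]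
  · refine sum_nbij' (fun i => i.1) (fun k => (k, t)) ?_ ?_ ?_ ?_ ?_
    · intro i hi
      rw [mem_filter, mem_TK2 hL] at hi
      rw [mem_Icc]; omega
    · intro k hk
      rw [mem_Icc] at hk
      refine mem_filter.2 ⟨(mem_TK2 hL).2 ?_, rfl⟩
      simp only; omega
    · intro i hi
      rw [mem_filter] at hi
      ext <;> simp [hi.2]
    · simp
    · intro i hi
      rw [mem_filter] at hi
      rw [hi.2]

theorem leaveFlow_eq (hℓ : 1 ≤ D.ℓ) {t : ℤ} (ht : D.t₀ ≤ t) :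
    leaveFlow D e t = ∑ k ∈ Icc (t + D.ℓ + 1) D.T, e.z t k := by
  refine sum_nbij' (fun i => i.2) (fun k => (t, k)) ?_ ?_ ?_ ?_ ?_
  · intro i hi
    rw [mem_filter, mem_KT hℓ] at hi
    rw [mem_Icc]; omega
  · intro k hk
    rw [mem_Icc] at hk
    refine mem_filter.2 ⟨(mem_KT hℓ).2 ?_, rfl⟩
    simp only; omega
  · intro i hi
    rw [mem_filter] at hi
    ext <;> simp [hi.2]
  · simp
  · intro i hi
    rw [mem_filter] at hi
    rw [hi.2]

theorem startFlow_eq (hL : 1 ≤ D.L) {t : ℤ} (ht : t ∈ Icc (D.t₀ + D.ℓ + 1) D.T) :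
    startFlow D e t = ∑ k ∈ Icc (min (t + D.L - 1) D.T) D.T, e.y t k := by
  rw [mem_Icc] at ht
  refine sum_nbij' (fun i => i.2) (fun k => (t, k)) ?_ ?_ ?_ ?_ ?_
  · intro i hi
    rw [mem_filter, mem_TK2 hL] at hi
    rw [mem_Icc]; omega
  · intro k hk
    rw [mem_Icc] at hk
    refine mem_filter.2 ⟨(mem_TK2 hL).2 ?_, rfl⟩
    simp only; omega
  · intro i hi
    rw [mem_filter] at hi
    ext <;> simp [hi.2]
  · simp
  · intro i hi
    rw [mem_filter] at hi
    rw [hi.2]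

theorem sum_KT_snd (hℓ : 1 ≤ D.ℓ) (g : ℤ → ℤ → ℝ) {t : ℤ} (ht : t ≤ D.T) :
    ∑ i ∈ (KT D).filter (fun i => i.2 = t), g i.1 i.2
      = ∑ k ∈ Icc D.t₀ (t - D.ℓ - 1), g k t := by
  refine sum_nbij' (fun i => i.1) (fun k => (k, t)) ?_ ?_ ?_ ?_ ?_
  · intro i hi
    rw [mem_filter, mem_KT hℓ] at hi
    rw [mem_Icc]; omega
  · intro k hk
    rw [mem_Icc] at hk
    refine mem_filter.2 ⟨(mem_KT hℓ).2 ?_, rfl⟩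
    simp only; omega
  · intro i hi
    rw [mem_filter] at hi
    ext <;> simp [hi.2]
  · simp
  · intro i hi
    rw [mem_filter] at hi
    rw [hi.2]

theorem vOf_eq (hℓ : 1 ≤ D.ℓ) {t : ℤ} (ht : t ≤ D.T) :
    vOf D e t = ∑ k ∈ Icc D.t₀ (t - D.ℓ - 1), e.z k t := sum_KT_snd hℓ e.z ht

theorem vOf_eq_zero (hℓ : 1 ≤ D.ℓ) {t : ℤ} (ht : t ≤ D.t₀ + D.ℓ) : vOf D e t = 0 := by
  refine sum_eq_zero fun i hi => ?_
  rw [mem_filter, mem_KT hℓ] at hi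
  omega

theorem startFlow_eq_zero (hL : 1 ≤ D.L) {t : ℤ} (ht : t ≤ D.t₀ + D.ℓ) :
    startFlow D e t = 0 := by
  refine sum_eq_zero fun i hi => ?_
  rw [mem_filter, mem_TK2 hL] at hi
  omega

theorem endFlow_eq_zero (hL : 1 ≤ D.L) (hℓ : 1 ≤ D.ℓ) {t : ℤ} (ht : t < D.t₀) :
    endFlow D e t = 0 := by
  unfold endFlow
  rw [sum_eq_zero, sum_eq_zero, add_zero]
  · intro i hi
    rw [mem_filter, mem_TK2 hL] at hi
    omega
  · intro i hi
    rw [mem_filter, mem_Icc] at hi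
    omega

/-- The EUC objective as a sum over time. -/
theorem EUCObj_eq (hL : 1 ≤ D.L) (hℓ : 1 ≤ D.ℓ) :
    EUCObj D e
      = ∑ s ∈ Icc 1 D.T, ∑ i ∈ (TK D).filter (fun i => i.1 ≤ s ∧ s ≤ i.2), e.φ i.1 i.2 s
        + ∑ t ∈ Icc (D.t₀ + D.ℓ + 1) D.T, startCost D e t
        + ∑ t ∈ Icc D.t₀ (D.T - 1), shutCost D e t := by
  have h0 := t₀_nonneg D
  have h1 : ∑ i ∈ TK D, ∑ s ∈ Icc i.1 i.2, e.φ i.1 i.2 s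
      = ∑ s ∈ Icc 1 D.T, ∑ i ∈ (TK D).filter (fun i => i.1 ≤ s ∧ s ≤ i.2), e.φ i.1 i.2 s := by
    refine sum_comm' fun i s => ?_
    rw [mem_filter, TK, mem_union, mem_TK1, mem_TK2 hL, mem_Icc, mem_Icc]
    omega
  have h2 : ∑ i ∈ KT D, D.S (i.2 - i.1 - 1) * e.z i.1 i.2
      = ∑ t ∈ Icc (D.t₀ + D.ℓ + 1) D.T, startCost D e t := by
    rw [← sum_fiberwise_of_maps_to (t := Icc (D.t₀ + D.ℓ + 1) D.T) (g := fun i => i.2)]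
    · refine sum_congr rfl fun t ht => ?_
      rw [mem_Icc] at ht
      exact sum_KT_snd hℓ (fun k t => D.S (t - k - 1) * e.z k t) ht.2
    · intro i hi
      rw [mem_KT hℓ] at hi
      rw [mem_Icc]; omega
  have h3 : ∑ t ∈ Icc (D.t₀ + D.ℓ + 1) (D.T - D.L), ∑ k ∈ Icc (t + D.L - 1) (D.T - 1),
        D.S' (k - t + 1) * e.y t k
      = ∑ t ∈ Icc D.t₀ (D.T - 1), ∑ k ∈ Icc (D.t₀ + D.ℓ + 1) (t - D.L + 1),
        D.S' (t - k + 1) * e.y k t := by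
    refine sum_comm' fun i s => ?_
    simp only [mem_Icc]
    omega
  rw [EUCObj, h1, h2, h3]
  simp only [shutCost, sum_add_distrib]
  ring

/-! ### Conservation of flow and its consequences -/

namespace EUCFeasible

theorem flow_balance (he : EUCFeasible D e) (hL : 1 ≤ D.L) (hℓ : 1 ≤ D.ℓ)
    {t : ℤ} (ht : t ∈ Icc D.t₀ (D.T - 1)) :
    leaveFlow D e t + e.θ t = endFlow D e t := by
  have := he.flow_down t ht
  rw [leaveFlow_eq hℓ (mem_Icc.1 ht).1, endFlow_eq hL ht]
  linarith

theorem startFlow_eq_vOf (he : EUCFeasible D e) (hL : 1 ≤ D.L) (hℓ : 1 ≤ D.ℓ)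
    {t : ℤ} (ht : t ≤ D.T) : startFlow D e t = vOf D e t := by
  by_cases h : t ≤ D.t₀ + D.ℓ
  · rw [startFlow_eq_zero hL h, vOf_eq_zero hℓ h]
  · have hm : t ∈ Icc (D.t₀ + D.ℓ + 1) D.T := by rw [mem_Icc]; omega
    have := he.flow_up t hm
    rw [startFlow_eq hL hm, vOf_eq hℓ ht]
    linarith

/-- For `t > T - ℓ - 1` no sign is imposed on `θ`, but no off-interval fits before the horizon
either, so flow balance makes `θ t` equal to the flow ending at `t`. -/
theorem θ_nonneg_of_lt (he : EUCFeasible D e) (hL : 1 ≤ D.L) (hℓ : 1 ≤ D.ℓ)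
    {t : ℤ} (ht : t ∈ Icc D.t₀ (D.T - 1)) : 0 ≤ e.θ t := by
  by_cases h : t ≤ D.T - D.ℓ - 1
  · exact he.θ_nonneg t (mem_Icc.2 ⟨(mem_Icc.1 ht).1, h⟩)
  · have h1 := he.flow_balance hL hℓ ht
    rw [leaveFlow_eq hℓ (mem_Icc.1 ht).1, Icc_eq_empty (by omega), sum_empty, zero_add,
      endFlow_eq hL ht] at h1
    rw [mem_Icc] at ht
    rw [h1]
    refine add_nonneg (he.w_nonneg t (mem_Icc.2 (by omega))) (sum_nonneg fun k hk => ?_)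
    refine he.y_nonneg k t ((mem_TK2 hL).2 ?_)
    rw [mem_Icc] at hk
    simp only; omega

theorem sum_z_nonneg (he : EUCFeasible D e) (P : ℤ × ℤ → Prop) [DecidablePred P] :
    0 ≤ ∑ i ∈ (KT D).filter P, e.z i.1 i.2 :=
  sum_nonneg fun i hi => he.z_nonneg i.1 i.2 (mem_filter.1 hi).1

theorem sum_y_nonneg (he : EUCFeasible D e) (P : ℤ × ℤ → Prop) [DecidablePred P] :
    0 ≤ ∑ i ∈ (TK2 D).filter P, e.y i.1 i.2 :=
  sum_nonneg fun i hi => he.y_nonneg i.1 i.2 (mem_filter.1 hi).1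

theorem sum_w_nonneg (he : EUCFeasible D e) (P : ℤ → Prop) [DecidablePred P] :
    0 ≤ ∑ i ∈ (Icc D.t₀ D.T).filter P, e.w i :=
  sum_nonneg fun i hi => he.w_nonneg i (mem_filter.1 hi).1

theorem weight_nonneg (he : EUCFeasible D e) {i : ℤ × ℤ} (hi : i ∈ TK D) :
    0 ≤ weight D e i := by
  unfold weight
  split_ifs with h
  · rw [mem_TK1] at h
    exact he.w_nonneg _ (mem_Icc.2 (by omega))
  · exact he.y_nonneg _ _ ((mem_union.1 hi).resolve_left h)

theorem onFlow_nonneg (he : EUCFeasible D e) (s : ℤ) : 0 ≤ onFlow D e s :=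
  add_nonneg (he.sum_w_nonneg _) (he.sum_y_nonneg _)

theorem endFlow_nonneg (he : EUCFeasible D e) (s : ℤ) : 0 ≤ endFlow D e s :=
  add_nonneg (he.sum_w_nonneg _) (he.sum_y_nonneg _)

theorem sum_θ_nonneg (he : EUCFeasible D e) (hL : 1 ≤ D.L) (hℓ : 1 ≤ D.ℓ) {s : ℤ}
    (hs : s ≤ D.T) : 0 ≤ ∑ t ∈ Icc D.t₀ (s - 1), e.θ t := by
  refine sum_nonneg fun t ht => he.θ_nonneg_of_lt hL hℓ ?_
  rw [mem_Icc] at *; omega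

theorem onFlow_eq_one (he : EUCFeasible D e) (hL : 1 ≤ D.L) (hℓ : 1 ≤ D.ℓ)
    {s : ℤ} (hs : s ≤ D.t₀) : onFlow D e s = 1 := by
  rw [onFlow, filter_true_of_mem, he.sum_w, sum_eq_zero, add_zero]
  · intro i hi
    rw [mem_filter, mem_TK2 hL] at hi
    omega
  · intro k hk
    rw [mem_Icc] at hk; omega

/-- At each time the flow through the network is one. -/
theorem onFlow_add_offFlow (he : EUCFeasible D e) (hL : 1 ≤ D.L) (hℓ : 1 ≤ D.ℓ)
    {s : ℤ} (hs : D.t₀ ≤ s) (hsT : s ≤ D.T) : onFlow D e s + offFlow D e s = 1 := by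
  induction s, hs using Int.leInduction with
  | base =>
    rw [he.onFlow_eq_one hL hℓ le_rfl, offFlow, sum_eq_zero, Icc_eq_empty (by omega)]
    · simp
    · intro i hi
      rw [mem_filter, mem_KT hℓ] at hi
      omega
  | succ s hs ih =>
    have h1 := he.flow_balance hL hℓ (t := s) (mem_Icc.2 (by omega))
    have h2 := he.startFlow_eq_vOf hL hℓ hsT
    have h3 := ih (by omega)
    rw [onFlow_succ hL, offFlow_succ hℓ hs]
    linarith

theorem onFlow_le_one (he : EUCFeasible D e) (hL : 1 ≤ D.L) (hℓ : 1 ≤ D.ℓ)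
    {s : ℤ} (hsT : s ≤ D.T) : onFlow D e s ≤ 1 := by
  by_cases hs : s ≤ D.t₀
  · exact (he.onFlow_eq_one hL hℓ hs).le
  · have h1 := he.onFlow_add_offFlow hL hℓ (s := s) (by omega) hsT
    have h2 := he.sum_θ_nonneg hL hℓ hsT
    have h3 := he.sum_z_nonneg (fun i => i.1 < s ∧ s < i.2)
    unfold offFlow at h1
    linarith

/-- The intervals ending at `s` carry no more than the off-flow at `s + 1`. -/
theorem endFlow_le (he : EUCFeasible D e) (hL : 1 ≤ D.L) (hℓ : 1 ≤ D.ℓ)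
    {s : ℤ} (hsT : s + 1 ≤ D.T) : endFlow D e s ≤ 1 - onFlow D e (s + 1) := by
  by_cases hs : s < D.t₀
  · rw [endFlow_eq_zero hL hℓ hs]
    linarith [he.onFlow_le_one hL hℓ hsT]
  · have h1 := he.onFlow_add_offFlow hL hℓ (s := s + 1) (by omega) hsT
    have h2 := he.sum_θ_nonneg hL hℓ (s := s) (by omega)
    have h3 := he.flow_balance hL hℓ (t := s) (mem_Icc.2 (by omega))
    have h4 : Icc D.t₀ (s + 1 - 1) = insert s (Icc D.t₀ (s - 1)) := by
      ext t; simp only [mem_insert, mem_Icc]; omega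
    -- Flow ending at `s` splits into `θ s` and off-intervals from `s`; the latter last at least `ℓ
    -- ≥ 1` periods, so they cover `s + 1`.
    have h5 : leaveFlow D e s
        ≤ ∑ i ∈ (KT D).filter (fun i => i.1 < s + 1 ∧ s + 1 < i.2), e.z i.1 i.2 := by
      refine sum_le_sum_of_subset_of_nonneg (fun i hi => ?_)
        fun i hi _ => he.z_nonneg _ _ (mem_filter.1 hi).1
      rw [mem_filter, mem_KT hℓ] at *
      omega
    rw [offFlow, h4, sum_insert (by simp)] at h1
    linarith

/-- The intervals ending at `s` carry no more than the on-flow at `s`. -/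
theorem endFlow_le_onFlow (he : EUCFeasible D e) (hL : 1 ≤ D.L) (s : ℤ) :
    endFlow D e s ≤ onFlow D e s := by
  refine add_le_add ?_ ?_
  · refine sum_le_sum_of_subset_of_nonneg (fun i hi => ?_)
      fun i hi _ => he.w_nonneg _ (mem_filter.1 hi).1
    rw [mem_filter] at *; exact ⟨hi.1, hi.2.ge⟩
  · refine sum_le_sum_of_subset_of_nonneg (fun i hi => ?_)
      fun i hi _ => he.y_nonneg _ _ (mem_filter.1 hi).1
    rw [mem_filter, mem_TK2 hL] at *; omega

/-- An off-interval that ends in the window `[t - ℓ + 1, t]` is long enough to cover `t - ℓ`, so all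
of them share the off-flow at that time. -/
theorem sum_vOf_le (he : EUCFeasible D e) (hL : 1 ≤ D.L) (hℓ : 1 ≤ D.ℓ)
    {t : ℤ} (ht : t ∈ Icc (D.t₀ + D.ℓ) D.T) :
    ∑ i ∈ Icc (t - D.ℓ + 1) t, vOf D e i ≤ 1 - onFlow D e (t - D.ℓ) := by
  rw [mem_Icc] at ht
  have h1 := he.onFlow_add_offFlow hL hℓ (s := t - D.ℓ) (by omega) (by omega)
  have h2 := he.sum_θ_nonneg hL hℓ (s := t - D.ℓ) (by omega)
  have h3 : ∑ i ∈ Icc (t - D.ℓ + 1) t, vOf D e i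
      ≤ ∑ i ∈ (KT D).filter (fun i => i.1 < t - D.ℓ ∧ t - D.ℓ < i.2), e.z i.1 i.2 := by
    have : ∑ i ∈ Icc (t - D.ℓ + 1) t, vOf D e i
        = ∑ i ∈ (KT D).filter (fun i => i.2 ∈ Icc (t - D.ℓ + 1) t), e.z i.1 i.2 := 
        sum_fiberwise_eq_sum_filter _ _ (fun i : ℤ × ℤ => i.2) fun i => e.z i.1 i.2
    rw [this]
    refine sum_le_sum_of_subset_of_nonneg (fun i hi => ?_)
      fun i hi _ => he.z_nonneg _ _ (mem_filter.1 hi).1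
    rw [mem_filter, mem_KT hℓ] at *
    rw [mem_Icc] at hi
    omega
  unfold offFlow at h1
  linarith

/-- By `flow_up`, start-up flow continues into on-intervals. Those starting within the last `L`
periods have not ended before `t`, so all of them cover `t`. -/
theorem sum_vOf_le_onFlow (he : EUCFeasible D e) (hL : 1 ≤ D.L) (hℓ : 1 ≤ D.ℓ)
    {t : ℤ} (ht : t ≤ D.T) :
    ∑ i ∈ Icc (t - D.L + 1) t, vOf D e i ≤ onFlow D e t := by
  have : ∑ i ∈ Icc (t - D.L + 1) t, vOf D e i
      = ∑ i ∈ (TK2 D).filter (fun i => i.1 ∈ Icc (t - D.L + 1) t), e.y i.1 i.2 := by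
    rw [← sum_fiberwise_eq_sum_filter _ _ (fun i : ℤ × ℤ => i.1) fun i => e.y i.1 i.2]
    exact sum_congr rfl fun s hs =>
      (he.startFlow_eq_vOf hL hℓ ((mem_Icc.1 hs).2.trans ht)).symm
  rw [this, onFlow]
  refine le_add_of_nonneg_of_le (he.sum_w_nonneg _) ?_
  refine sum_le_sum_of_subset_of_nonneg (fun i hi => ?_)
    fun i hi _ => he.y_nonneg _ _ (mem_filter.1 hi).1
  rw [mem_filter, mem_TK2 hL] at *
  rw [mem_Icc] at hi
  omega

theorem vOf_le (he : EUCFeasible D e) (hL : 1 ≤ D.L) (hℓ : 1 ≤ D.ℓ)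
    {t : ℤ} (ht : t ≤ D.T) : vOf D e t ≤ 1 - onFlow D e (t - 1) := by
  by_cases h : t ≤ D.t₀ + D.ℓ
  · rw [vOf_eq_zero hℓ h]
    linarith [he.onFlow_le_one hL hℓ (s := t - 1) (by omega)]
  · have h1 := he.onFlow_add_offFlow hL hℓ (s := t - 1) (by omega) (by omega)
    have h2 := he.sum_θ_nonneg hL hℓ (s := t - 1) (by omega)
    have h3 : vOf D e t
        ≤ ∑ i ∈ (KT D).filter (fun i => i.1 < t - 1 ∧ t - 1 < i.2), e.z i.1 i.2 := by
      refine sum_le_sum_of_subset_of_nonneg (fun i hi => ?_)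
        fun i hi _ => he.z_nonneg _ _ (mem_filter.1 hi).1
      rw [mem_filter, mem_KT hℓ] at *
      omega
    unfold offFlow at h1
    linarith

/-! ### Production and cost of an on-interval -/

theorem one_le_fst_of_mem_TK (hL : 1 ≤ D.L) (hℓ : 1 ≤ D.ℓ) {i : ℤ × ℤ} (hi : i ∈ TK D) :
    1 ≤ i.1 ∧ i.1 ≤ i.2 ∧ i.2 ≤ D.T := by
  have := t₀_nonneg D
  rw [TK, mem_union, mem_TK1, mem_TK2 hL] at hi
  omega

theorem weight_bounds (he : EUCFeasible D e) {i : ℤ × ℤ} (hi : i ∈ TK D) {s : ℤ}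
    (hs : i.1 ≤ s ∧ s ≤ i.2) :
    D.Cmin * weight D e i ≤ e.q i.1 i.2 s ∧ e.q i.1 i.2 s ≤ D.Cmax * weight D e i := by
  unfold weight
  split_ifs with h
  · exact he.bounds1 _ _ h s (mem_Icc.2 hs)
  · exact he.bounds2 _ _ ((mem_union.1 hi).resolve_left h) s (mem_Icc.2 hs)

theorem weight_ramp (he : EUCFeasible D e) {i : ℤ × ℤ} (hi : i ∈ TK D) {s : ℤ}
    (hs : i.1 + 1 ≤ s ∧ s ≤ i.2) :
    e.q i.1 i.2 (s - 1) - e.q i.1 i.2 s ≤ D.V * weight D e i ∧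
      e.q i.1 i.2 s - e.q i.1 i.2 (s - 1) ≤ D.V * weight D e i := by
  unfold weight
  split_ifs with h
  · exact he.ramp1 _ _ h s (mem_Icc.2 hs)
  · exact he.ramp2 _ _ ((mem_union.1 hi).resolve_left h) s (mem_Icc.2 hs)

theorem weight_shut_ramp (he : EUCFeasible D e) {i : ℤ × ℤ} (hi : i ∈ TK D)
    (hs : i.2 ≤ D.T - 1) : e.q i.1 i.2 i.2 ≤ D.Vbar * weight D e i := by
  unfold weight
  split_ifs with h
  · exact he.shut_ramp1 _ _ h hs
  · exact he.shut_ramp2 _ _ ((mem_union.1 hi).resolve_left h) hs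

theorem weight_start_ramp (he : EUCFeasible D e) {i : ℤ × ℤ} (hi : i ∈ TK D)
    (hs : 2 ≤ i.1) : e.q i.1 i.2 i.1 ≤ D.Vbar * weight D e i := by
  unfold weight
  split_ifs with h
  · rw [mem_TK1] at h; omega
  · exact he.start_ramp _ _ ((mem_union.1 hi).resolve_left h)

theorem weight_cost (he : EUCFeasible D e) {i : ℤ × ℤ} (hi : i ∈ TK D) {s : ℤ}
    (hs : i.1 ≤ s ∧ s ≤ i.2) (j : Fin D.N) :
    D.b j s * weight D e i ≤ e.φ i.1 i.2 s - D.a j s * e.q i.1 i.2 s := by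
  unfold weight
  split_ifs with h
  · exact he.cost1 _ _ h s (mem_Icc.2 hs) j
  · exact he.cost2 _ _ ((mem_union.1 hi).resolve_left h) s (mem_Icc.2 hs) j

theorem xOf_bounds (he : EUCFeasible D e) (hL : 1 ≤ D.L) (hℓ : 1 ≤ D.ℓ) {s : ℤ} (hs : 1 ≤ s) :
    D.Cmin * onFlow D e s ≤ xOf D e s ∧ xOf D e s ≤ D.Cmax * onFlow D e s := by
  rw [onFlow_eq_sum_weight hL hℓ hs, xOf, mul_sum, mul_sum]
  exact ⟨sum_le_sum fun i hi =>
      (he.weight_bounds (mem_filter.1 hi).1 (mem_filter.1 hi).2).1,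
    sum_le_sum fun i hi => (he.weight_bounds (mem_filter.1 hi).1 (mem_filter.1 hi).2).2⟩

/-- For each linear piece the cost constraints can be summed over the intervals covering `s`; only
then is the maximum over pieces taken. -/
theorem f_le (he : EUCFeasible D e) (hL : 1 ≤ D.L) (hℓ : 1 ≤ D.ℓ) (hN : 1 ≤ D.N) {s : ℤ}
    (hs : 1 ≤ s) : D.f s (xOf D e s) (onFlow D e s)
      ≤ ∑ i ∈ (TK D).filter (fun i => i.1 ≤ s ∧ s ≤ i.2), e.φ i.1 i.2 s := by
  have : Nonempty (Fin D.N) := ⟨⟨0, hN⟩⟩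
  refine ciSup_le fun j => ?_
  rw [onFlow_eq_sum_weight hL hℓ hs, xOf, mul_sum, mul_sum, ← sum_add_distrib]
  refine sum_le_sum fun i hi => ?_
  linarith [he.weight_cost (mem_filter.1 hi).1 (mem_filter.1 hi).2 j]

/-- Each interval is estimated separately: one starting at `t` adds at most `Vbar` times its weight,
one covering both times at most `V` times its weight, and one ending at `t - 1` only lowers the
output. The start-up flow is then absorbed by `vOf_le`. Time `1` is excluded because initial
intervals have no start-up ramp. -/
theorem xOf_sub_le (he : EUCFeasible D e) (hL : 1 ≤ D.L) (hℓ : 1 ≤ D.ℓ) (hC : 0 ≤ D.Cmin)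
    (hV : 0 ≤ D.V) (hVbar : 0 ≤ D.Vbar) {t : ℤ} (ht : 2 ≤ t) (htT : t ≤ D.T) :
    xOf D e t - xOf D e (t - 1)
      ≤ D.V * onFlow D e (t - 1) + D.Vbar * (1 - onFlow D e (t - 1)) := by
  have h1 : xOf D e t - xOf D e (t - 1) ≤ D.V * onFlow D e (t - 1) + D.Vbar * vOf D e t := by
    rw [← he.startFlow_eq_vOf hL hℓ htT, startFlow_eq_sum_weight hL hℓ ht,
      onFlow_eq_sum_weight hL hℓ (by omega), xOf, xOf, mul_sum, mul_sum]
    simp only [sum_filter, ← sum_add_distrib, ← sum_sub_distrib]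
    refine sum_le_sum fun i hi => ?_
    have hi' := one_le_fst_of_mem_TK hL hℓ hi
    have hw := he.weight_nonneg hi
    by_cases c1 : i.1 = t
    · have := he.weight_start_ramp hi (by omega)
      subst c1
      simp [hi'.2.1, this]
    · by_cases c2 : i.1 ≤ t - 1 ∧ t - 1 ≤ i.2
      · by_cases c3 : i.1 ≤ t ∧ t ≤ i.2
        · simp only [c1, c2, c3, and_self, if_true, if_false]
          linarith [(he.weight_ramp hi (s := t) (by omega)).2]
        · simp only [c1, c2, c3, and_self, if_true, if_false]
          have := (he.weight_bounds hi c2).1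
          have := mul_nonneg hC hw
          have := mul_nonneg hV hw
          linarith
      · have c3 : ¬ (i.1 ≤ t ∧ t ≤ i.2) := by omega
        simp only [c1, c2, c3, if_false]
        simp
  have h2 := mul_le_mul_of_nonneg_left (he.vOf_le hL hℓ htT) hVbar
  linarith

/-- Time-reversed counterpart of `xOf_sub_le`, with ending intervals in place of starting ones and
`endFlow_le` in place of `vOf_le`. -/
theorem sub_xOf_le (he : EUCFeasible D e) (hL : 1 ≤ D.L) (hℓ : 1 ≤ D.ℓ) (hC : 0 ≤ D.Cmin)
    (hV : 0 ≤ D.V) (hVbar : 0 ≤ D.Vbar) {t : ℤ} (ht : 1 ≤ t) (htT : t + 1 ≤ D.T) :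
    xOf D e t - xOf D e (t + 1)
      ≤ D.V * onFlow D e (t + 1) + D.Vbar * (1 - onFlow D e (t + 1)) := by
  have h1 : xOf D e t - xOf D e (t + 1) ≤ D.V * onFlow D e (t + 1) + D.Vbar * endFlow D e t := by
    rw [endFlow_eq_sum_weight hL hℓ ht,
      onFlow_eq_sum_weight hL hℓ (by omega), xOf, xOf, mul_sum, mul_sum]
    simp only [sum_filter, ← sum_add_distrib, ← sum_sub_distrib]
    refine sum_le_sum fun i hi => ?_
    have hi' := one_le_fst_of_mem_TK hL hℓ hi
    have hw := he.weight_nonneg hi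
    by_cases c1 : i.2 = t
    · have := he.weight_shut_ramp hi (by omega)
      subst c1
      simp [hi'.2.1, this]
    · by_cases c2 : i.1 ≤ t + 1 ∧ t + 1 ≤ i.2
      · by_cases c3 : i.1 ≤ t ∧ t ≤ i.2
        · simp only [c1, c2, c3, and_self, if_true, if_false]
          have := (he.weight_ramp hi (s := t + 1) (by omega)).1
          rw [add_sub_cancel_right] at this
          linarith
        · simp only [c1, c2, c3, and_self, if_true, if_false]
          have := (he.weight_bounds hi c2).1
          have := mul_nonneg hC hw
          have := mul_nonneg hV hw
          linarith
      · have c3 : ¬ (i.1 ≤ t ∧ t ≤ i.2) := by omega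
        simp only [c1, c2, c3, if_false]
        simp
  have h2 := mul_le_mul_of_nonneg_left (he.endFlow_le hL hℓ htT) hVbar
  linarith

end EUCFeasible

/-! ### Integrality -/

theorem sum_eq_zero_or_one {ι : Type*} {s : Finset ι} {g : ι → ℝ}
    (hg : ∀ i ∈ s, g i = 0 ∨ g i = 1) (h : ∑ i ∈ s, g i ≤ 1) :
    (∀ i ∈ s, g i = 0) ∨ ∑ i ∈ s, g i = 1 ∧ ∃ i ∈ s, g i = 1 := by
  by_cases h0 : ∀ i ∈ s, g i = 0
  · exact Or.inl h0
  · push Not at h0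
    obtain ⟨i, hi, hi0⟩ := h0
    have hi1 := (hg i hi).resolve_left hi0
    refine Or.inr ⟨le_antisymm h ?_, i, hi, hi1⟩
    rw [← hi1]
    refine single_le_sum (fun j hj => ?_) hi
    rcases hg j hj with h | h <;> simp [h]

namespace EUCFeasible

theorem onFlow_binary (he : EUCFeasible D e) (hint : EUCIntegral D e) (hL : 1 ≤ D.L)
    (hℓ : 1 ≤ D.ℓ) {s : ℤ} (hs : s ≤ D.T) : onFlow D e s = 0 ∨ onFlow D e s = 1 := by
  have h := he.onFlow_le_one hL hℓ hs
  have hw := he.sum_w_nonneg (fun k => s ≤ k)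
  have hy := he.sum_y_nonneg (fun i => i.1 ≤ s ∧ s ≤ i.2)
  unfold onFlow at *
  rcases sum_eq_zero_or_one (fun k hk => hint.w k (mem_filter.1 hk).1)
    (by linarith : ∑ k ∈ (Icc D.t₀ D.T).filter (fun k => s ≤ k), e.w k ≤ 1) with h1 | h1
  · rw [sum_eq_zero h1] at h ⊢
    rcases sum_eq_zero_or_one (fun k hk => hint.y k.1 k.2 (mem_filter.1 hk).1)
      (by linarith : ∑ i ∈ (TK2 D).filter (fun i => i.1 ≤ s ∧ s ≤ i.2), e.y i.1 i.2 ≤ 1)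
      with h2 | h2
    · rw [sum_eq_zero h2]; simp
    · rw [h2.1]; simp
  · right; linarith [h1.1]

theorem vOf_cases (he : EUCFeasible D e) (hint : EUCIntegral D e) (hL : 1 ≤ D.L)
    (hℓ : 1 ≤ D.ℓ) {s : ℤ} (hs : s ≤ D.T) :
    vOf D e s = 0 ∨ vOf D e s = 1 ∧ ∃ k, (k, s) ∈ KT D ∧ e.z k s = 1 := by
  have h := he.vOf_le hL hℓ hs
  have h' := he.onFlow_nonneg (s - 1)
  unfold vOf at *
  rcases sum_eq_zero_or_one (fun i hi => hint.z i.1 i.2 (mem_filter.1 hi).1)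
    (by linarith : ∑ i ∈ (KT D).filter (fun i => i.2 = s), e.z i.1 i.2 ≤ 1)
    with h1 | ⟨h1, i, hi, h2⟩
  · exact Or.inl (sum_eq_zero h1)
  · obtain ⟨h3, rfl⟩ := mem_filter.1 hi
    exact Or.inr ⟨h1, i.1, h3, h2⟩

theorem exists_y_of_vOf (he : EUCFeasible D e) (hint : EUCIntegral D e) (hL : 1 ≤ D.L)
    (hℓ : 1 ≤ D.ℓ) {s : ℤ} (hs : s ≤ D.T) (hv : vOf D e s = 1) :
    ∃ k, (s, k) ∈ TK2 D ∧ e.y s k = 1 := by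
  rw [← he.startFlow_eq_vOf hL hℓ hs] at hv
  unfold startFlow at *
  rcases sum_eq_zero_or_one (fun i hi => hint.y i.1 i.2 (mem_filter.1 hi).1) hv.le
    with h1 | ⟨h1, i, hi, h2⟩
  · rw [sum_eq_zero h1] at hv; norm_num at hv
  · obtain ⟨h3, rfl⟩ := mem_filter.1 hi
    exact ⟨i.2, h3, h2⟩

theorem w_le_endFlow (he : EUCFeasible D e) {t : ℤ} (ht : t ∈ Icc D.t₀ D.T) :
    e.w t ≤ endFlow D e t := by
  refine le_add_of_le_of_nonneg ?_ (he.sum_y_nonneg _)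
  exact single_le_sum (f := e.w) (fun k hk => he.w_nonneg k (mem_filter.1 hk).1)
    (mem_filter.2 ⟨ht, rfl⟩)

theorem y_le_endFlow (he : EUCFeasible D e) {t k : ℤ} (h : (t, k) ∈ TK2 D) :
    e.y t k ≤ endFlow D e k := by
  refine le_add_of_nonneg_of_le (he.sum_w_nonneg _) ?_
  exact single_le_sum (f := fun i : ℤ × ℤ => e.y i.1 i.2) (a := (t, k))
    (fun i hi => he.y_nonneg i.1 i.2 (mem_filter.1 hi).1) (mem_filter.2 ⟨h, rfl⟩)

theorem w_le_onFlow (he : EUCFeasible D e) {s t : ℤ} (ht : t ∈ Icc D.t₀ D.T) (hs : s ≤ t) :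
    e.w t ≤ onFlow D e s := by
  refine le_add_of_le_of_nonneg ?_ (he.sum_y_nonneg _)
  exact single_le_sum (f := e.w) (fun k hk => he.w_nonneg k (mem_filter.1 hk).1)
    (mem_filter.2 ⟨ht, hs⟩)

theorem y_le_onFlow (he : EUCFeasible D e) {s t k : ℤ} (h : (t, k) ∈ TK2 D) (h1 : t ≤ s)
    (h2 : s ≤ k) : e.y t k ≤ onFlow D e s := by
  refine le_add_of_nonneg_of_le (he.sum_w_nonneg _) ?_
  exact single_le_sum (f := fun i : ℤ × ℤ => e.y i.1 i.2) (a := (t, k))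
    (fun i hi => he.y_nonneg i.1 i.2 (mem_filter.1 hi).1) (mem_filter.2 ⟨h, h1, h2⟩)

/-- Flow entering an off-interval at `k` comes from an on-interval ending at `k`, which covers `k`.
-/
theorem z_le_onFlow (he : EUCFeasible D e) (hL : 1 ≤ D.L) (hℓ : 1 ≤ D.ℓ) {k t : ℤ}
    (h : (k, t) ∈ KT D) : e.z k t ≤ onFlow D e k := by
  have h' := (mem_KT hℓ).1 h
  simp only at h'
  have hk : k ∈ Icc D.t₀ (D.T - 1) := mem_Icc.2 (by omega)
  have h1 : e.z k t ≤ leaveFlow D e k :=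
    single_le_sum (f := fun i : ℤ × ℤ => e.z i.1 i.2) (a := (k, t))
      (fun i hi => he.z_nonneg i.1 i.2 (mem_filter.1 hi).1) (mem_filter.2 ⟨h, rfl⟩)
  linarith [he.flow_balance hL hℓ hk, he.θ_nonneg_of_lt hL hℓ hk, he.endFlow_le_onFlow hL k]

/-! ### Cost brackets of an integral solution -/

/-- Let `[1, k]` be the initial interval in use. If `k < t`, the off period `k + 1` already cancels
the bracket; if `k > t`, the on period `t + 1` does; if `k = t`, the right side is one. -/
theorem shut_first_bracket_le (he : EUCFeasible D e) (hint : EUCIntegral D e) (hL : 1 ≤ D.L)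
    (hℓ : 1 ≤ D.ℓ) {t : ℤ} (ht : t ∈ Icc D.t₀ (D.T - 1)) :
    1 - onFlow D e (t + 1) - ∑ s ∈ Icc 1 t, (1 - onFlow D e s) ≤ e.w t := by
  have h0 := t₀_nonneg D
  rw [mem_Icc] at ht
  have hn : ∀ s ∈ Icc 1 t, 0 ≤ 1 - onFlow D e s := fun s hs => by
    rw [mem_Icc] at hs
    linarith [he.onFlow_le_one hL hℓ (s := s) (by omega)]
  have hsum := sum_nonneg hn
  have ht1 := he.onFlow_nonneg (t + 1)
  have hwt := he.w_nonneg t (mem_Icc.2 (by omega))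
  rcases sum_eq_zero_or_one hint.w he.sum_w.le with h | ⟨-, k, hk, hwk⟩
  · have := he.sum_w
    rw [sum_eq_zero h] at this
    norm_num at this
  have hk' := mem_Icc.1 hk
  rcases lt_trichotomy k t with hkt | rfl | hkt
  · have h1 := he.w_le_endFlow hk
    have h2 := he.endFlow_le hL hℓ (s := k) (by omega)
    have h3 := single_le_sum hn (mem_Icc.2 (by omega) : k + 1 ∈ Icc 1 t)
    linarith
  · linarith
  · have := he.w_le_onFlow hk (s := t + 1) (by omega)
    linarith

/-- Same trichotomy as in `shut_first_bracket_le`, for the end `j` of the on-interval starting at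
`k`; without a start-up at `k` the bracket is nonpositive. -/
theorem shut_later_bracket_le (he : EUCFeasible D e) (hint : EUCIntegral D e) (hL : 1 ≤ D.L)
    (hℓ : 1 ≤ D.ℓ) {k t : ℤ} (h : (k, t) ∈ TK2 D) (ht : t ≤ D.T - 1) :
    vOf D e k - ∑ s ∈ Icc k t, (1 - onFlow D e s) - onFlow D e (t + 1) ≤ e.y k t := by
  have h' := (mem_TK2 hL).1 h
  simp only at h'
  have hn : ∀ s ∈ Icc k t, 0 ≤ 1 - onFlow D e s := fun s hs => by
    rw [mem_Icc] at hs
    linarith [he.onFlow_le_one hL hℓ (s := s) (by omega)]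
  have hsum := sum_nonneg hn
  have ht1 := he.onFlow_nonneg (t + 1)
  have hy := he.y_nonneg k t h
  rcases he.vOf_cases hint hL hℓ (s := k) (by omega) with hv | ⟨hv, -⟩
  · linarith
  obtain ⟨j, hj, hyj⟩ := he.exists_y_of_vOf hint hL hℓ (by omega) hv
  have hj' := (mem_TK2 hL).1 hj
  simp only at hj'
  rcases lt_trichotomy j t with hjt | rfl | hjt
  · have h1 := he.y_le_endFlow hj
    have h2 := he.endFlow_le hL hℓ (s := j) (by omega)
    have h3 := single_le_sum hn (mem_Icc.2 (by omega) : j + 1 ∈ Icc k t)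
    linarith
  · linarith
  · have := he.y_le_onFlow hj (s := t + 1) (by omega) (by omega)
    linarith

theorem startCost_nonneg (he : EUCFeasible D e) (hℓ : 1 ≤ D.ℓ)
    (hS : ∀ n, D.ℓ ≤ n → 0 ≤ D.S n) {t : ℤ} (ht : t ≤ D.T) : 0 ≤ startCost D e t := by
  refine sum_nonneg fun k hk => ?_
  rw [mem_Icc] at hk
  exact mul_nonneg (hS _ (by omega)) (he.z_nonneg _ _ ((mem_KT hℓ).2 (by simp only; omega)))

/-- Let the off-interval `(j, t)` be in use. If `j > k`, the on period `j` makes the bracket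
nonpositive. Otherwise the constraint charges for a shorter off-time than the true one, and
monotonicity of `S` bounds it by the true cost. -/
theorem start_le (he : EUCFeasible D e) (hint : EUCIntegral D e) (hL : 1 ≤ D.L)
    (hℓ : 1 ≤ D.ℓ) (hS : ∀ n, D.ℓ ≤ n → 0 ≤ D.S n)
    (hSmono : ∀ m n, D.ℓ ≤ m → m ≤ n → D.S m ≤ D.S n) {t k : ℤ} (htT : t ≤ D.T)
    (hk : k ∈ Icc D.t₀ (t - D.ℓ - 1)) :
    D.S (t - k - 1) * (vOf D e t - ∑ s ∈ Icc (k + 1) (t - 1), onFlow D e s)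
      ≤ startCost D e t := by
  rw [mem_Icc] at hk
  have hn : ∀ s ∈ Icc (k + 1) (t - 1), 0 ≤ onFlow D e s := fun s _ => he.onFlow_nonneg s
  have hsum := sum_nonneg hn
  have hc := he.startCost_nonneg hℓ hS htT
  have hSk := hS (t - k - 1) (by omega)
  rcases he.vOf_cases hint hL hℓ htT with hv | ⟨hv, j, hj, hz⟩
  · exact (mul_nonpos_of_nonneg_of_nonpos hSk (by linarith)).trans hc
  have hj' := (mem_KT hℓ).1 hj
  simp only at hj'
  by_cases hjk : k < j
  · have h1 := he.z_le_onFlow hL hℓ hj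
    have h2 := single_le_sum hn (mem_Icc.2 (by omega) : j ∈ Icc (k + 1) (t - 1))
    exact (mul_nonpos_of_nonneg_of_nonpos hSk (by linarith)).trans hc
  · calc _ ≤ D.S (t - k - 1) * 1 := mul_le_mul_of_nonneg_left (by linarith) hSk
      _ ≤ D.S (t - j - 1) * e.z j t := by
        rw [hz, mul_one, mul_one]; exact hSmono _ _ (by omega) (by omega)
      _ ≤ startCost D e t :=
        single_le_sum (f := fun k => D.S (t - k - 1) * e.z k t)
          (fun i hi => by
            rw [mem_Icc] at hi
            exact mul_nonneg (hS _ (by omega))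
              (he.z_nonneg _ _ ((mem_KT hℓ).2 (by simp only; omega))))
          (mem_Icc.2 (by omega))

end EUCFeasible

/-! ### From EUC to UC -/

/-- The 2-Bin solution induced by a solution of EUC. -/
def toUC (D : Data) (e : EUCVars) : UCVars where
  -- The free `x₀` is set equal to `x₁`, which makes both ramp constraints at time `1` trivial.
  x s := xOf D e (max s 1)
  u := onFlow D e
  v := vOf D e
  ζ := startCost D e
  ζ' := shutCost D e

theorem toUC_feasible (he : EUCFeasible D e) (hint : EUCIntegral D e) (hL : 1 ≤ D.L)
    (hℓ : 1 ≤ D.ℓ) (hC : 0 ≤ D.Cmin) (hV : 0 ≤ D.V) (hVbar : 0 ≤ D.Vbar)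
    (hS : ∀ n, D.ℓ ≤ n → 0 ≤ D.S n) (hS' : ∀ n, D.L ≤ n → 0 ≤ D.S' n)
    (hSmono : ∀ m n, D.ℓ ≤ m → m ≤ n → D.S m ≤ D.S n) : UCFeasible D (toUC D e) := by
  have ht0 := t₀_nonneg D
  have hLs := le_t₀_add D
  have hw : ∀ t ∈ Icc D.t₀ (D.T - 1), 0 ≤ D.S' (t + D.s₀) * e.w t := fun t ht => by
    rw [mem_Icc] at ht
    exact mul_nonneg (hS' _ (by omega)) (he.w_nonneg _ (mem_Icc.2 (by omega)))
  have hmem : ∀ t ∈ Icc D.t₀ (D.T - 1), ∀ k ∈ Icc (D.t₀ + D.ℓ + 1) (t - D.L + 1),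
      (k, t) ∈ TK2 D := fun t ht k hk => by
    rw [mem_Icc] at ht hk
    exact (mem_TK2 hL).2 (by simp only; omega)
  have hy : ∀ t ∈ Icc D.t₀ (D.T - 1), ∀ k ∈ Icc (D.t₀ + D.ℓ + 1) (t - D.L + 1),
      0 ≤ D.S' (t - k + 1) * e.y k t := fun t ht k hk => by
    refine mul_nonneg (hS' _ ?_) (he.y_nonneg _ _ (hmem t ht k hk))
    rw [mem_Icc] at hk; omega
  constructor
  case init_on => exact fun t ht => he.onFlow_eq_one hL hℓ (mem_Icc.1 ht).2
  case min_up => exact fun t ht => he.sum_vOf_le_onFlow hL hℓ (mem_Icc.1 ht).2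
  case min_down => exact fun t ht => he.sum_vOf_le hL hℓ ht
  case logic =>
    intro t ht
    have h1 := onFlow_succ (e := e) hL (s := t - 1)
    rw [sub_add_cancel, he.startFlow_eq_vOf hL hℓ (mem_Icc.1 ht).2] at h1
    have := he.endFlow_nonneg (t - 1)
    simp only [toUC]
    linarith
  case lower =>
    intro t ht
    have ht1 := (mem_Icc.1 ht).1
    have := (he.xOf_bounds hL hℓ ht1).1
    simp only [toUC, max_eq_left ht1]
    linarith
  case upper =>
    intro t ht
    have ht1 := (mem_Icc.1 ht).1
    have := (he.xOf_bounds hL hℓ ht1).2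
    simp only [toUC, max_eq_left ht1]
    linarith
  case ramp_up =>
    intro t ht
    rw [mem_Icc] at ht
    simp only [toUC]
    by_cases h : t = 1
    · subst h
      have h0 := he.onFlow_eq_one hL hℓ ht0
      simpa [h0] using hV
    · rw [max_eq_left (by omega), max_eq_left (by omega)]
      exact he.xOf_sub_le hL hℓ hC hV hVbar (by omega) ht.2
  case ramp_down =>
    intro t ht
    rw [mem_Icc] at ht
    simp only [toUC]
    by_cases h : t = 1
    · subst h
      have h1 := mul_nonneg hV (he.onFlow_nonneg 1)
      have h2 := mul_nonneg hVbar (sub_nonneg.2 (he.onFlow_le_one hL hℓ ht.2))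
      simpa using add_nonneg h1 h2
    · rw [max_eq_left (by omega), max_eq_left (by omega)]
      have := he.sub_xOf_le hL hℓ hC hV hVbar (t := t - 1) (by omega) (by omega)
      rwa [sub_add_cancel] at this
  case shut_first =>
    intro t ht
    have h := mul_le_mul_of_nonneg_left (he.shut_first_bracket_le hint hL hℓ ht)
      (hS' (t + D.s₀) (by rw [mem_Icc] at ht; omega))
    exact h.trans (le_add_of_nonneg_right (sum_nonneg (hy t ht)))
  case shut_later =>
    intro t ht k hk
    have ht' : t ∈ Icc D.t₀ (D.T - 1) := by rw [mem_Icc] at *; omega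
    have h := mul_le_mul_of_nonneg_left
      (he.shut_later_bracket_le hint hL hℓ (hmem t ht' k hk) (mem_Icc.1 ht).2)
      (hS' (t - k + 1) (by rw [mem_Icc] at hk; omega))
    exact h.trans (le_add_of_nonneg_of_le (hw t ht')
      (single_le_sum (f := fun k => D.S' (t - k + 1) * e.y k t) (hy t ht') hk))
  case start => exact fun t ht k hk => he.start_le hint hL hℓ hS hSmono (mem_Icc.1 ht).2 hk
  case u_binary => exact fun t ht => he.onFlow_binary hint hL hℓ (mem_Icc.1 ht).2
  case v_binary =>
    exact fun t ht => (he.vOf_cases hint hL hℓ (mem_Icc.1 ht).2).imp_right And.left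
  case ζ_nonneg => exact fun t ht => he.startCost_nonneg hℓ hS (mem_Icc.1 ht).2
  case ζ'_nonneg => exact fun t ht => add_nonneg (hw t ht) (sum_nonneg (hy t ht))
  case u_zero => exact he.onFlow_eq_one hL hℓ ht0

theorem UCObj_toUC_le (he : EUCFeasible D e) (hL : 1 ≤ D.L) (hℓ : 1 ≤ D.ℓ) (hN : 1 ≤ D.N) :
    UCObj D (toUC D e) ≤ EUCObj D e := by
  rw [EUCObj_eq hL hℓ, UCObj]
  refine add_le_add_left (add_le_add_left (sum_le_sum fun s hs => ?_) _) _
  have hs1 := (mem_Icc.1 hs).1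
  simp only [toUC, max_eq_left hs1]
  exact he.f_le hL hℓ hN hs1

/-! ### Runs of integers -/

theorem exists_run_end {R : ℤ → Prop} {a b : ℤ} (hab : a ≤ b) (ha : R a) :
    ∃ c, a ≤ c ∧ c ≤ b ∧ (∀ s, a ≤ s → s ≤ c → R s) ∧ (c = b ∨ ¬ R (c + 1)) := by
  induction b, hab using Int.leInduction with
  | base =>
    refine ⟨a, le_rfl, le_rfl, fun s h1 h2 => ?_, Or.inl rfl⟩
    rwa [le_antisymm h2 h1]
  | succ b hab ih =>
    obtain ⟨c, hac, hcb, hR, h⟩ := ih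
    by_cases hc : R (c + 1)
    · obtain rfl : c = b := h.resolve_right (not_not_intro hc)
      refine ⟨c + 1, by omega, le_rfl, fun s h1 h2 => ?_, Or.inl rfl⟩
      rcases eq_or_lt_of_le h2 with rfl | h3
      · exact hc
      · exact hR s h1 (by omega)
    · exact ⟨c, hac, by omega, hR, Or.inr hc⟩

theorem exists_run_start {R : ℤ → Prop} {a b : ℤ} (hab : a ≤ b) (hb : R b) :
    ∃ c, a ≤ c ∧ c ≤ b ∧ (∀ s, c ≤ s → s ≤ b → R s) ∧ (c = a ∨ ¬ R (c - 1)) := by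
  obtain ⟨c, h1, h2, h3, h4⟩ :=
    exists_run_end (R := fun s => R (-s)) (neg_le_neg hab) (by simpa using hb)
  refine ⟨-c, by omega, by omega, fun s hs hs' => ?_, ?_⟩
  · simpa using h3 (-s) (by omega) (by omega)
  · rcases h4 with h4 | h4
    · left; omega
    · right
      have : -c - 1 = -(c + 1) := by ring
      rwa [this]

open Classical in
theorem sum_indicator_eq_one {ι : Type*} {s : Finset ι} {P : ι → Prop} {i : ι} (hi : i ∈ s)
    (hP : P i) (huniq : ∀ j ∈ s, P j → j = i) : ∑ j ∈ s, (if P j then (1 : ℝ) else 0) = 1 := by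
  rw [sum_eq_single_of_mem i hi fun j hj hji => if_neg fun h => hji (huniq j hj h), if_pos hP]

open Classical in
theorem sum_indicator_eq_zero {ι : Type*} {s : Finset ι} {P : ι → Prop}
    (h : ∀ j ∈ s, ¬ P j) : ∑ j ∈ s, (if P j then (1 : ℝ) else 0) = 0 :=
  sum_eq_zero fun j hj => if_neg (h j hj)

/-! ### On- and off-intervals of a 2-Bin schedule -/

/-- The generator is on from time `0` to time `k` exactly. -/
def InitialRun (D : Data) (p : UCVars) (k : ℤ) : Prop :=
  (∀ s, 0 ≤ s → s ≤ k → p.u s = 1) ∧ (k = D.T ∨ p.u (k + 1) ≠ 1)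

/-- The generator is on from time `t` to time `k` exactly. -/
def OnRun (D : Data) (p : UCVars) (t k : ℤ) : Prop :=
  p.u (t - 1) ≠ 1 ∧ (∀ s, t ≤ s → s ≤ k → p.u s = 1) ∧ (k = D.T ∨ p.u (k + 1) ≠ 1)

/-- The generator shuts down at time `k + 1` and starts up next at time `t`. -/
def OffRun (p : UCVars) (k t : ℤ) : Prop :=
  p.u k = 1 ∧ (∀ s, k < s → s < t → p.u s ≠ 1) ∧ p.u t = 1

/-- Off is expressed as `≠ 1`, so on and off are complementary without binarity; `u_eq_zero`
recovers the value zero within `[0, T]`. -/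
def StartUp (p : UCVars) (t : ℤ) : Prop := p.u (t - 1) ≠ 1 ∧ p.u t = 1

def ShutDown (p : UCVars) (t : ℤ) : Prop := p.u t = 1 ∧ p.u (t + 1) ≠ 1

/-! ### Minimal run lengths forced by the 2-Bin constraints -/

namespace UCFeasible

variable {p : UCVars}

theorem u_eq_zero (hp : UCFeasible D p) {t : ℤ} (h0 : 0 ≤ t) (hT : t ≤ D.T) (h : p.u t ≠ 1) :
    p.u t = 0 := by
  rcases eq_or_lt_of_le h0 with rfl | h0
  · exact absurd hp.u_zero h
  · exact (hp.u_binary t (mem_Icc.2 (by omega))).resolve_right h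

theorem u_eq_one_of_le (hp : UCFeasible D p) {t : ℤ} (h0 : 0 ≤ t) (ht : t ≤ D.t₀) :
    p.u t = 1 := by
  rcases eq_or_lt_of_le h0 with rfl | h0
  · exact hp.u_zero
  · exact hp.init_on t (mem_Icc.2 (by omega))

theorem v_nonneg (hp : UCFeasible D p) {t : ℤ} (h1 : 1 ≤ t) (hT : t ≤ D.T) : 0 ≤ p.v t := by
  rcases hp.v_binary t (mem_Icc.2 ⟨h1, hT⟩) with h | h <;> simp [h]

theorem v_eq_one (hp : UCFeasible D p) {t : ℤ} (h1 : 1 ≤ t) (hT : t ≤ D.T)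
    (hs : StartUp p t) : p.v t = 1 := by
  have h := hp.logic t (mem_Icc.2 ⟨h1, hT⟩)
  rw [hs.2, hp.u_eq_zero (by omega) (by omega) hs.1] at h
  rcases hp.v_binary t (mem_Icc.2 ⟨h1, hT⟩) with h' | h'
  · rw [h'] at h; norm_num at h
  · exact h'

theorem one_le_sum_v (hp : UCFeasible D p) {a b i : ℤ} (ha : 1 ≤ a) (hb : b ≤ D.T)
    (hi : i ∈ Icc a b) (hs : StartUp p i) : 1 ≤ ∑ j ∈ Icc a b, p.v j := by
  have hi' := mem_Icc.1 hi
  rw [← hp.v_eq_one (by omega) (by omega) hs]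
  exact single_le_sum (fun j hj => by
    rw [mem_Icc] at hj; exact hp.v_nonneg (by omega) (by omega)) hi

/-- Two distinct start-ups in a window would contribute two to the sum of `v`. -/
theorem eq_of_startUp (hp : UCFeasible D p) {a b i j : ℤ} (ha : 1 ≤ a) (hb : b ≤ D.T)
    (hi : i ∈ Icc a b) (hj : j ∈ Icc a b) (hsi : StartUp p i) (hsj : StartUp p j)
    (hsum : ∑ j ∈ Icc a b, p.v j ≤ 1) : i = j := by
  by_contra hne
  have h : ∑ k ∈ {i, j}, p.v k ≤ ∑ j ∈ Icc a b, p.v j := by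
    refine sum_le_sum_of_subset_of_nonneg ?_ fun k hk _ => ?_
    · intro k hk
      rcases mem_insert.1 hk with rfl | hk
      · exact hi
      · rwa [mem_singleton.1 hk]
    · rw [mem_Icc] at hk; exact hp.v_nonneg (by omega) (by omega)
  rw [mem_Icc] at hi hj
  rw [sum_pair hne, hp.v_eq_one (by omega) (by omega) hsi,
    hp.v_eq_one (by omega) (by omega) hsj] at h
  linarith

/-- The min-down constraint at `t₀ + ℓ` reads `∑ v ≤ 1 - u t₀ = 0`. If `hdown` fails to supply this
constraint, then `T ≤ t₀ + 1`, which leaves no room for an off period before a start-up. -/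
theorem lt_of_startUp (hp : UCFeasible D p)
    (hdown : D.t₀ + D.ℓ ≤ D.T ∨ D.T ≤ D.t₀ + 1) {t : ℤ} (h1 : 1 ≤ t) (hT : t ≤ D.T)
    (hs : StartUp p t) : D.t₀ + D.ℓ < t := by
  by_contra h
  have h0 := t₀_nonneg D
  have h2 : D.t₀ < t - 1 := by
    by_contra h2
    exact hs.1 (hp.u_eq_one_of_le (by omega) (by omega))
  have h3 := hp.min_down (D.t₀ + D.ℓ) (mem_Icc.2 (by omega))
  rw [add_sub_cancel_right, hp.u_eq_one_of_le h0 le_rfl] at h3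
  have h4 := hp.one_le_sum_v (a := D.t₀ + 1) (b := D.t₀ + D.ℓ) (by omega) (by omega)
    (mem_Icc.2 (by omega)) hs
  linarith

/-- The start-up at `t` forces `u (t - ℓ) = 0` in the min-down constraint. An on period in the
window would then belong to a run with its own start-up there, a second one. -/
theorem off_before_startUp (hp : UCFeasible D p) (hℓ : 1 ≤ D.ℓ)
    (hdown : D.t₀ + D.ℓ ≤ D.T ∨ D.T ≤ D.t₀ + 1) {t : ℤ} (h1 : 1 ≤ t) (hT : t ≤ D.T)
    (hs : StartUp p t) {s : ℤ} (hs1 : t - D.ℓ ≤ s) (hs2 : s < t) : p.u s ≠ 1 := by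
  intro hus
  have h0 := t₀_nonneg D
  have hlt := hp.lt_of_startUp hdown h1 hT hs
  have hsum := hp.min_down t (mem_Icc.2 (by omega))
  have hone := hp.one_le_sum_v (a := t - D.ℓ + 1) (b := t) (by omega) hT
    (mem_Icc.2 (by omega)) hs
  have hoff : p.u (t - D.ℓ) ≠ 1 := by
    intro h; rw [h] at hsum; linarith
  rw [hp.u_eq_zero (by omega) (by omega) hoff] at hsum
  obtain ⟨c, hc1, hc2, hc3, hc4⟩ := exists_run_start (R := fun s => p.u s = 1) hs1 hus
  have hcs := hc3 c le_rfl hc2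
  rcases hc4 with rfl | hc4
  · exact hoff hcs
  · have hct : c ≠ t - D.ℓ := by rintro rfl; exact hoff hcs
    have := hp.eq_of_startUp (a := t - D.ℓ + 1) (b := t) (i := c) (j := t) (by omega) hT
      (mem_Icc.2 (by omega)) (mem_Icc.2 (by omega)) ⟨hc4, hcs⟩ hs (by linarith)
    omega

theorem on_after_startUp (hp : UCFeasible D p) (hL : 1 ≤ D.L) (hℓ : 1 ≤ D.ℓ)
    (hdown : D.t₀ + D.ℓ ≤ D.T ∨ D.T ≤ D.t₀ + 1)
    (hup : D.t₀ + D.ℓ + D.L ≤ D.T ∨ D.T ≤ D.t₀ + D.ℓ + 1) {t : ℤ} (h1 : 1 ≤ t) (hT : t ≤ D.T)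
    (hs : StartUp p t) {s : ℤ} (hs1 : t ≤ s) (hs2 : s ≤ t + D.L - 1) (hsT : s ≤ D.T) :
    p.u s = 1 := by
  have h0 := t₀_nonneg D
  have hlt := hp.lt_of_startUp hdown h1 hT hs
  by_contra hus
  have hst : s ≠ t := by rintro rfl; exact hus hs.2
  -- `r` is `t + L - 1` cut off at the horizon. In the cut-off case `hup` provides the min-up
  -- constraint at `T`; its other alternative forces `t = T`, contrary to `t < s ≤ T`.
  obtain ⟨r, hr1, hr2, hr3, hr4⟩ : ∃ r, s ≤ r ∧ r ≤ D.T ∧ r ≤ t + D.L - 1 ∧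
      D.t₀ + D.ℓ + D.L ≤ r := by
    by_cases h : t + D.L - 1 ≤ D.T
    · exact ⟨t + D.L - 1, by omega⟩
    · exact ⟨D.T, by omega⟩
  have hsum := hp.min_up r (mem_Icc.2 ⟨hr4, hr2⟩)
  have hone := hp.one_le_sum_v (a := r - D.L + 1) (b := r) (by omega) hr2
    (mem_Icc.2 (by omega)) hs
  have hur : p.u r = 1 := by
    by_contra h
    rw [hp.u_eq_zero (by omega) hr2 h] at hsum
    linarith
  -- The run leading up to `r` begins after the off period `s`, giving a second start-up in a window
  -- that allows only one.
  obtain ⟨c, hc1, hc2, hc3, hc4⟩ := exists_run_start (R := fun s => p.u s = 1) hr1 hur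
  have hcs := hc3 c le_rfl hc2
  rcases hc4 with rfl | hc4
  · exact hus hcs
  · have := hp.eq_of_startUp (a := r - D.L + 1) (b := r) (i := t) (j := c) (by omega) hr2
      (mem_Icc.2 (by omega)) (mem_Icc.2 (by omega)) hs ⟨hc4, hcs⟩ (by linarith)
    omega

theorem x_eq_zero (hp : UCFeasible D p) {t : ℤ} (h1 : 1 ≤ t) (hT : t ≤ D.T)
    (h : p.u t ≠ 1) : p.x t = 0 := by
  have hl := hp.lower t (mem_Icc.2 ⟨h1, hT⟩)
  have hu := hp.upper t (mem_Icc.2 ⟨h1, hT⟩)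
  rw [hp.u_eq_zero (by omega) hT h] at hl hu
  linarith

end UCFeasible

/-! ### The EUC solution of a 2-Bin schedule -/

open Classical in
def runW (D : Data) (p : UCVars) (k : ℤ) : ℝ := if InitialRun D p k then 1 else 0

open Classical in
def runY (D : Data) (p : UCVars) (t k : ℤ) : ℝ := if OnRun D p t k then 1 else 0

open Classical in
def runZ (p : UCVars) (k t : ℤ) : ℝ := if OffRun p k t then 1 else 0

def runWeight (D : Data) (p : UCVars) (t k : ℤ) : ℝ :=
  if (t, k) ∈ TK1 D then runW D p k else runY D p t k

/-- The EUC solution whose intervals are the on- and off-intervals of a 2-Bin schedule. -/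
def toEUC (D : Data) (p : UCVars) : EUCVars where
  w := runW D p
  y := runY D p
  z := runZ p
  -- `θ` is solved from the flow equation, so only its nonnegativity remains to be shown.
  θ t := runW D p t - ∑ k ∈ Icc (t + D.ℓ + 1) D.T, runZ p t k
    + ∑ k ∈ Icc (D.t₀ + D.ℓ + 1) (t - D.L + 1), runY D p k t
  q t k s := p.x s * runWeight D p t k
  φ t k s := D.f s (p.x s) 1 * runWeight D p t k

namespace UCFeasible

variable {p : UCVars}

theorem sum_runW (hp : UCFeasible D p) (hT : D.t₀ ≤ D.T) :
    ∑ k ∈ Icc D.t₀ D.T, runW D p k = 1 := by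
  have h0 := t₀_nonneg D
  obtain ⟨c, hc1, hc2, hc3, hc4⟩ := exists_run_end (R := fun s => p.u s = 1) hT
    (hp.u_eq_one_of_le h0 le_rfl)
  have hc : InitialRun D p c := by
    refine ⟨fun s hs0 hsc => ?_, hc4⟩
    by_cases hs : s ≤ D.t₀
    · exact hp.u_eq_one_of_le hs0 hs
    · exact hc3 s (by omega) hsc
  refine sum_indicator_eq_one (P := InitialRun D p) (mem_Icc.2 ⟨hc1, hc2⟩) hc fun j hj hR => ?_
  rw [mem_Icc] at hj
  rcases lt_trichotomy j c with h | h | h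
  · exact absurd (hc.1 (j + 1) (by omega) (by omega)) (hR.2.resolve_left (by omega))
  · exact h
  · exact absurd (hR.1 (c + 1) (by omega) (by omega)) (hc.2.resolve_left (by omega))

open Classical in
-- A start-up opens exactly one on-run, and `on_after_startUp` puts its end in the summation range.
theorem sum_runY_right (hp : UCFeasible D p) (hL : 1 ≤ D.L) (hℓ : 1 ≤ D.ℓ)
    (hdown : D.t₀ + D.ℓ ≤ D.T ∨ D.T ≤ D.t₀ + 1)
    (hup : D.t₀ + D.ℓ + D.L ≤ D.T ∨ D.T ≤ D.t₀ + D.ℓ + 1) {t : ℤ}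
    (ht : t ∈ Icc (D.t₀ + D.ℓ + 1) D.T) :
    ∑ k ∈ Icc (min (t + D.L - 1) D.T) D.T, runY D p t k = if StartUp p t then 1 else 0 := by
  have h0 := t₀_nonneg D
  rw [mem_Icc] at ht
  split_ifs with hs
  · obtain ⟨c, hc1, hc2, hc3, hc4⟩ := exists_run_end (R := fun s => p.u s = 1) ht.2 hs.2
    have hc : OnRun D p t c := ⟨hs.1, hc3, hc4⟩
    have hmin : min (t + D.L - 1) D.T ≤ c := by
      by_contra h
      exact (hc.2.2.resolve_left (by omega)) (hp.on_after_startUp hL hℓ hdown hup (by omega)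
        ht.2 hs (s := c + 1) (by omega) (by omega) (by omega))
    refine sum_indicator_eq_one (P := OnRun D p t) (mem_Icc.2 ⟨hmin, hc2⟩) hc fun j hj hR => ?_
    rw [mem_Icc] at hj
    rcases lt_trichotomy j c with h | h | h
    · exact absurd (hc3 (j + 1) (by omega) (by omega)) (hR.2.2.resolve_left (by omega))
    · exact h
    · exact absurd (hR.2.1 (c + 1) (by omega) (by omega)) (hc.2.2.resolve_left (by omega))
  · refine sum_indicator_eq_zero (P := OnRun D p t) fun k hk hR => hs ⟨hR.1, ?_⟩
    rw [mem_Icc] at hk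
    exact hR.2.1 t le_rfl (by omega)

open Classical in
-- Tracing back from a start-up gives exactly one off-run. It begins after `t₀`, and
-- `off_before_startUp` makes it long enough to be in the range.
theorem sum_runZ_left (hp : UCFeasible D p) (hℓ : 1 ≤ D.ℓ)
    (hdown : D.t₀ + D.ℓ ≤ D.T ∨ D.T ≤ D.t₀ + 1) {t : ℤ}
    (ht : t ∈ Icc (D.t₀ + D.ℓ + 1) D.T) :
    ∑ k ∈ Icc D.t₀ (t - D.ℓ - 1), runZ p k t = if StartUp p t then 1 else 0 := by
  have h0 := t₀_nonneg D
  rw [mem_Icc] at ht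
  split_ifs with hs
  · obtain ⟨c, hc1, hc2, hc3, hc4⟩ := exists_run_start (R := fun s => p.u s ≠ 1)
      (a := 0) (b := t - 1) (by omega) hs.1
    have hct : D.t₀ < c := by
      by_contra h
      exact hc3 c le_rfl hc2 (hp.u_eq_one_of_le hc1 (by omega))
    have hc5 : p.u (c - 1) = 1 := not_not.1 (hc4.resolve_left (by omega))
    have hc6 : c ≤ t - D.ℓ := by
      by_contra h
      exact hp.off_before_startUp hℓ hdown (by omega) ht.2 hs (s := c - 1) (by omega)
        (by omega) hc5
    have hc : OffRun p (c - 1) t :=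
      ⟨hc5, fun s h1 h2 => hc3 s (by omega) (by omega), hs.2⟩
    refine sum_indicator_eq_one (P := fun k => OffRun p k t) (i := c - 1)
      (mem_Icc.2 (by omega)) hc fun j hj hR => ?_
    rw [mem_Icc] at hj
    rcases lt_trichotomy j (c - 1) with h | h | h
    · exact absurd hc5 (hR.2.1 (c - 1) (by omega) (by omega))
    · exact h
    · exact absurd hR.1 (hc.2.1 j (by omega) (by omega))
  · refine sum_indicator_eq_zero (P := fun k => OffRun p k t) fun k hk hR => hs ⟨?_, hR.2.2⟩
    rw [mem_Icc] at hk
    exact hR.2.1 (t - 1) (by omega) (by omega)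

open Classical in
-- A shut-down closes exactly one on-run: the initial one if tracing back reaches time `0`,
-- otherwise one with a start-up, of length at least `L`.
theorem runW_add_sum_runY (hp : UCFeasible D p) (hL : 1 ≤ D.L) (hℓ : 1 ≤ D.ℓ)
    (hdown : D.t₀ + D.ℓ ≤ D.T ∨ D.T ≤ D.t₀ + 1)
    (hup : D.t₀ + D.ℓ + D.L ≤ D.T ∨ D.T ≤ D.t₀ + D.ℓ + 1) {t : ℤ}
    (ht : t ∈ Icc D.t₀ (D.T - 1)) :
    runW D p t + ∑ k ∈ Icc (D.t₀ + D.ℓ + 1) (t - D.L + 1), runY D p k t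
      = if ShutDown p t then 1 else 0 := by
  have h0 := t₀_nonneg D
  rw [mem_Icc] at ht
  split_ifs with hs
  · obtain ⟨c, hc1, hc2, hc3, hc4⟩ := exists_run_start (R := fun s => p.u s = 1)
      (a := 0) (b := t) (by omega) hs.1
    by_cases hc0 : c = 0
    · subst hc0
      simp only [runY]
      rw [runW, if_pos ⟨hc3, Or.inr hs.2⟩,
        sum_indicator_eq_zero (P := fun k => OnRun D p k t) fun k hk hR => ?_, add_zero]
      rw [mem_Icc] at hk
      exact hR.1 (hc3 _ (by omega) (by omega))
    · have hc5 := hc4.resolve_left hc0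
      have hcs : StartUp p c := ⟨hc5, hc3 c le_rfl hc2⟩
      have hlt := hp.lt_of_startUp hdown (by omega) (by omega) hcs
      have hcL : c ≤ t - D.L + 1 := by
        by_contra h
        exact hs.2 (hp.on_after_startUp hL hℓ hdown hup (by omega) (by omega) hcs (by omega)
          (by omega) (by omega))
      simp only [runY]
      rw [runW, if_neg fun hR => hc5 (hR.1 _ (by omega) (by omega)),
        sum_indicator_eq_one (P := fun k => OnRun D p k t) (mem_Icc.2 (by omega))
          ⟨hc5, hc3, Or.inr hs.2⟩ fun j hj hR => ?_, zero_add]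
      rw [mem_Icc] at hj
      rcases lt_trichotomy j c with h | h | h
      · exact absurd (hR.2.1 (c - 1) (by omega) (by omega)) hc5
      · exact h
      · exact absurd (hc3 (j - 1) (by omega) (by omega)) hR.1
  · simp only [runY]
    rw [runW, if_neg fun hR =>
        hs ⟨hR.1 t (by omega) le_rfl, hR.2.resolve_left (by omega)⟩,
      sum_indicator_eq_zero (P := fun k => OnRun D p k t) fun k hk hR => ?_, add_zero]
    rw [mem_Icc] at hk
    exact hs ⟨hR.2.1 t (by omega) le_rfl, hR.2.2.resolve_left (by omega)⟩

open Classical in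
-- Only an inequality, since the unit may stay off until the horizon; the deficit is `θ`.
theorem sum_runZ_right_le (hℓ : 1 ≤ D.ℓ) {t : ℤ} :
    ∑ k ∈ Icc (t + D.ℓ + 1) D.T, runZ p t k ≤ if ShutDown p t then 1 else 0 := by
  by_cases hex : ∃ k ∈ Icc (t + D.ℓ + 1) D.T, OffRun p t k
  · obtain ⟨k, hk, hR⟩ := hex
    have hk' := mem_Icc.1 hk
    rw [if_pos ⟨hR.1, hR.2.1 (t + 1) (by omega) (by omega)⟩]
    refine (sum_indicator_eq_one (P := OffRun p t) hk hR fun j hj hRj => ?_).le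
    rw [mem_Icc] at hj
    rcases lt_trichotomy j k with h | h | h
    · exact absurd hRj.2.2 (hR.2.1 j (by omega) h)
    · exact h
    · exact absurd hR.2.2 (hRj.2.1 k (by omega) h)
  · push Not at hex
    have : ∑ k ∈ Icc (t + D.ℓ + 1) D.T, runZ p t k = 0 :=
      sum_indicator_eq_zero (P := OffRun p t) hex
    rw [this]
    split_ifs <;> norm_num

/-! ### Feasibility of the run solution -/

theorem runW_cases (D : Data) (p : UCVars) (k : ℤ) :
    runW D p k = 0 ∨ runW D p k = 1 ∧ InitialRun D p k := by
  unfold runW; split_ifs with h <;> simp [h]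

theorem runY_cases (D : Data) (p : UCVars) (t k : ℤ) :
    runY D p t k = 0 ∨ runY D p t k = 1 ∧ OnRun D p t k := by
  unfold runY; split_ifs with h <;> simp [h]

theorem runZ_cases (p : UCVars) (k t : ℤ) :
    runZ p k t = 0 ∨ runZ p k t = 1 ∧ OffRun p k t := by
  unfold runZ; split_ifs with h <;> simp [h]

theorem runWeight_eq_runW {t k : ℤ} (h : (t, k) ∈ TK1 D) : runWeight D p t k = runW D p k :=
  if_pos h

theorem runWeight_eq_runY (hL : 1 ≤ D.L) (hℓ : 1 ≤ D.ℓ) {t k : ℤ} (h : (t, k) ∈ TK2 D) :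
    runWeight D p t k = runY D p t k := if_neg (notMem_TK1_of_mem_TK2 hL hℓ h)

theorem bounds_of_on (hp : UCFeasible D p) {s : ℤ} (h1 : 1 ≤ s) (hT : s ≤ D.T)
    (h : p.u s = 1) : D.Cmin ≤ p.x s ∧ p.x s ≤ D.Cmax := by
  have hl := hp.lower s (mem_Icc.2 ⟨h1, hT⟩)
  have hu := hp.upper s (mem_Icc.2 ⟨h1, hT⟩)
  rw [h] at hl hu
  constructor <;> linarith

theorem ramp_of_on (hp : UCFeasible D p) {s : ℤ} (h1 : 1 ≤ s) (hT : s ≤ D.T)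
    (h : p.u (s - 1) = 1) (h' : p.u s = 1) :
    p.x (s - 1) - p.x s ≤ D.V ∧ p.x s - p.x (s - 1) ≤ D.V := by
  have hl := hp.ramp_down s (mem_Icc.2 ⟨h1, hT⟩)
  have hu := hp.ramp_up s (mem_Icc.2 ⟨h1, hT⟩)
  rw [h'] at hl
  rw [h] at hu
  constructor <;> linarith

theorem shut_ramp_of_off (hp : UCFeasible D p) {s : ℤ} (h1 : 0 ≤ s) (hT : s ≤ D.T - 1)
    (h : p.u (s + 1) ≠ 1) : p.x s ≤ D.Vbar := by
  have hl := hp.ramp_down (s + 1) (mem_Icc.2 (by omega))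
  rw [hp.u_eq_zero (by omega) (by omega) h, hp.x_eq_zero (by omega) (by omega) h,
    add_sub_cancel_right] at hl
  linarith

theorem start_ramp_of_off (hp : UCFeasible D p) {s : ℤ} (h1 : 2 ≤ s) (hT : s ≤ D.T)
    (h : p.u (s - 1) ≠ 1) : p.x s ≤ D.Vbar := by
  have hl := hp.ramp_up s (mem_Icc.2 (by omega))
  rw [hp.u_eq_zero (by omega) (by omega) h, hp.x_eq_zero (by omega) (by omega) h] at hl
  linarith

theorem le_f (D : Data) (j : Fin D.N) (s : ℤ) (x u : ℝ) :
    D.a j s * x + D.b j s * u ≤ D.f s x u :=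
  le_ciSup (f := fun j => D.a j s * x + D.b j s * u) (Set.finite_range _).bddAbove j

theorem toEUC_feasible (hp : UCFeasible D p) (hL : 1 ≤ D.L) (hℓ : 1 ≤ D.ℓ)
    (hdown : D.t₀ + D.ℓ ≤ D.T ∨ D.T ≤ D.t₀ + 1)
    (hup : D.t₀ + D.ℓ + D.L ≤ D.T ∨ D.T ≤ D.t₀ + D.ℓ + 1) (hT : D.t₀ ≤ D.T) :
    EUCFeasible D (toEUC D p) := by
  have h0 := t₀_nonneg D
  constructor
  case sum_w => exact hp.sum_runW hT
  case flow_down => intro t _; simp only [toEUC]; ring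
  case flow_up =>
    intro t ht
    simp only [toEUC]
    rw [hp.sum_runY_right hL hℓ hdown hup ht, hp.sum_runZ_left hℓ hdown ht, sub_self]
  case bounds1 =>
    intro t k h s hs
    rw [mem_Icc] at hs
    simp only [toEUC, runWeight_eq_runW h]
    rw [mem_TK1] at h; simp only at h
    rcases runW_cases D p k with hw | ⟨hw, hR⟩
    · simp [hw]
    · simpa [hw] using hp.bounds_of_on (s := s) (by omega) (by omega)
        (hR.1 s (by omega) (by omega))
  case bounds2 =>
    intro t k h s hs
    rw [mem_Icc] at hs
    simp only [toEUC, runWeight_eq_runY hL hℓ h]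
    rw [mem_TK2 hL] at h; simp only at h
    rcases runY_cases D p t k with hw | ⟨hw, hR⟩
    · simp [hw]
    · simpa [hw] using hp.bounds_of_on (s := s) (by omega) (by omega)
        (hR.2.1 s (by omega) (by omega))
  case start_ramp =>
    intro t k h
    simp only [toEUC, runWeight_eq_runY hL hℓ h]
    rw [mem_TK2 hL] at h; simp only at h
    rcases runY_cases D p t k with hw | ⟨hw, hR⟩
    · simp [hw]
    · simpa [hw] using hp.start_ramp_of_off (s := t) (by omega) (by omega) hR.1
  case shut_ramp1 =>
    intro t k h hk
    simp only [toEUC, runWeight_eq_runW h]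
    rw [mem_TK1] at h; simp only at h
    rcases runW_cases D p k with hw | ⟨hw, hR⟩
    · simp [hw]
    · simpa [hw] using hp.shut_ramp_of_off (s := k) (by omega) hk
        (hR.2.resolve_left (by omega))
  case shut_ramp2 =>
    intro t k h hk
    simp only [toEUC, runWeight_eq_runY hL hℓ h]
    rw [mem_TK2 hL] at h; simp only at h
    rcases runY_cases D p t k with hw | ⟨hw, hR⟩
    · simp [hw]
    · simpa [hw] using hp.shut_ramp_of_off (s := k) (by omega) hk
        (hR.2.2.resolve_left (by omega))
  case ramp1 =>
    intro t k h s hs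
    rw [mem_Icc] at hs
    simp only [toEUC, runWeight_eq_runW h]
    rw [mem_TK1] at h; simp only at h
    rcases runW_cases D p k with hw | ⟨hw, hR⟩
    · simp [hw]
    · simpa only [hw, mul_one] using hp.ramp_of_on (s := s) (by omega) (by omega)
        (hR.1 (s - 1) (by omega) (by omega)) (hR.1 s (by omega) (by omega))
  case ramp2 =>
    intro t k h s hs
    rw [mem_Icc] at hs
    simp only [toEUC, runWeight_eq_runY hL hℓ h]
    rw [mem_TK2 hL] at h; simp only at h
    rcases runY_cases D p t k with hw | ⟨hw, hR⟩
    · simp [hw]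
    · simpa only [hw, mul_one] using hp.ramp_of_on (s := s) (by omega) (by omega)
        (hR.2.1 (s - 1) (by omega) (by omega)) (hR.2.1 s (by omega) (by omega))
  case cost1 =>
    intro t k h s _ j
    simp only [toEUC, runWeight_eq_runW h]
    rcases runW_cases D p k with hw | ⟨hw, -⟩
    · simp [hw]
    · rw [hw]
      linarith [le_f D j s (p.x s) 1]
  case cost2 =>
    intro t k h s _ j
    simp only [toEUC, runWeight_eq_runY hL hℓ h]
    rcases runY_cases D p t k with hw | ⟨hw, -⟩
    · simp [hw]
    · rw [hw]
      linarith [le_f D j s (p.x s) 1]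
  case w_nonneg =>
    intro t _
    rcases runW_cases D p t with hw | ⟨hw, -⟩ <;> simp [toEUC, hw]
  case y_nonneg =>
    intro t k _
    rcases runY_cases D p t k with hw | ⟨hw, -⟩ <;> simp [toEUC, hw]
  case z_nonneg =>
    intro k t _
    rcases runZ_cases p k t with hw | ⟨hw, -⟩ <;> simp [toEUC, hw]
  case θ_nonneg =>
    intro t ht
    rw [mem_Icc] at ht
    have h1 := hp.runW_add_sum_runY hL hℓ hdown hup (t := t) (mem_Icc.2 (by omega))
    have h2 := sum_runZ_right_le (p := p) hℓ (t := t)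
    simp only [toEUC]
    linarith

/-! ### Cost of the run solution -/

/-- Both sides equal one at time `0` and change by the same start-up and shut-down indicators. -/
theorem onFlow_toEUC (hp : UCFeasible D p) (hL : 1 ≤ D.L) (hℓ : 1 ≤ D.ℓ)
    (hdown : D.t₀ + D.ℓ ≤ D.T ∨ D.T ≤ D.t₀ + 1)
    (hup : D.t₀ + D.ℓ + D.L ≤ D.T ∨ D.T ≤ D.t₀ + D.ℓ + 1) (hT : D.t₀ ≤ D.T) {s : ℤ}
    (hs : 0 ≤ s) (hsT : s ≤ D.T) : onFlow D (toEUC D p) s = p.u s := by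
  classical
  have h0 := t₀_nonneg D
  have he := hp.toEUC_feasible hL hℓ hdown hup hT
  induction s, hs using Int.leInduction with
  | base => rw [he.onFlow_eq_one hL hℓ h0, hp.u_zero]
  | succ s hs ih =>
    have hstart : startFlow D (toEUC D p) (s + 1) = if StartUp p (s + 1) then 1 else 0 := by
      by_cases h : s + 1 ≤ D.t₀ + D.ℓ
      · rw [startFlow_eq_zero hL h, if_neg]
        intro hst
        have := hp.lt_of_startUp hdown (by omega) hsT hst
        omega
      · have hm : s + 1 ∈ Icc (D.t₀ + D.ℓ + 1) D.T := mem_Icc.2 (by omega)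
        rw [startFlow_eq hL hm]
        exact hp.sum_runY_right hL hℓ hdown hup hm
    have hend : endFlow D (toEUC D p) s = if ShutDown p s then 1 else 0 := by
      by_cases h : s < D.t₀
      · rw [endFlow_eq_zero hL hℓ h, if_neg]
        exact fun hst => hst.2 (hp.u_eq_one_of_le (by omega) (by omega))
      · have hm : s ∈ Icc D.t₀ (D.T - 1) := mem_Icc.2 (by omega)
        rw [endFlow_eq hL hm]
        exact hp.runW_add_sum_runY hL hℓ hdown hup hm
    rw [onFlow_succ hL, ih (by omega), hstart, hend]
    simp only [StartUp, ShutDown, add_sub_cancel_right]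
    by_cases h1 : p.u s = 1 <;> by_cases h2 : p.u (s + 1) = 1
    · simp [h1, h2]
    · simp [h1, hp.u_eq_zero (by omega) hsT h2]
    · simp [h2, hp.u_eq_zero (by omega) (by omega) h1]
    · simp [hp.u_eq_zero (by omega) hsT h2, hp.u_eq_zero (by omega) (by omega) h1]

theorem sum_φ_toEUC (hp : UCFeasible D p) (hL : 1 ≤ D.L) (hℓ : 1 ≤ D.ℓ)
    (hdown : D.t₀ + D.ℓ ≤ D.T ∨ D.T ≤ D.t₀ + 1)
    (hup : D.t₀ + D.ℓ + D.L ≤ D.T ∨ D.T ≤ D.t₀ + D.ℓ + 1) (hT : D.t₀ ≤ D.T) {s : ℤ}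
    (hs : s ∈ Icc 1 D.T) :
    ∑ i ∈ (TK D).filter (fun i => i.1 ≤ s ∧ s ≤ i.2), (toEUC D p).φ i.1 i.2 s
      = D.f s (p.x s) (p.u s) := by
  rw [mem_Icc] at hs
  have h1 : ∑ i ∈ (TK D).filter (fun i => i.1 ≤ s ∧ s ≤ i.2), (toEUC D p).φ i.1 i.2 s
      = D.f s (p.x s) 1 * p.u s := by
    rw [← hp.onFlow_toEUC hL hℓ hdown hup hT (by omega) hs.2,
      onFlow_eq_sum_weight hL hℓ hs.1, mul_sum]
    rfl
  rw [h1]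
  by_cases hu : p.u s = 1
  · rw [hu, mul_one]
  -- An off period has `x = 0`, and `f` vanishes at `(0, 0)`.
  · rw [hp.u_eq_zero (by omega) hs.2 hu, hp.x_eq_zero hs.1 hs.2 hu]
    simp [Data.f]

theorem shutCost_toEUC_le (hp : UCFeasible D p) (hL : 1 ≤ D.L) (hℓ : 1 ≤ D.ℓ)
    (hdown : D.t₀ + D.ℓ ≤ D.T ∨ D.T ≤ D.t₀ + 1)
    (hup : D.t₀ + D.ℓ + D.L ≤ D.T ∨ D.T ≤ D.t₀ + D.ℓ + 1) {t : ℤ}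
    (ht : t ∈ Icc D.t₀ (D.T - 1)) : shutCost D (toEUC D p) t ≤ p.ζ' t := by
  classical
  have h0 := t₀_nonneg D
  have ht' := mem_Icc.1 ht
  have hζ := hp.ζ'_nonneg t ht
  have h1 : D.S' (t + D.s₀) * runW D p t ≤ p.ζ' t * runW D p t := by
    rcases runW_cases D p t with hw | ⟨hw, hR⟩
    · simp [hw]
    · have h := hp.shut_first t ht
      rw [hp.u_eq_zero (by omega) (by omega) (hR.2.resolve_left (by omega)),
        sum_eq_zero fun s hs => by
          rw [mem_Icc] at hs
          rw [hR.1 s (by omega) (by omega), sub_self]] at h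
      rw [hw]; linarith
  have h2 : ∑ k ∈ Icc (D.t₀ + D.ℓ + 1) (t - D.L + 1), D.S' (t - k + 1) * runY D p k t
      ≤ p.ζ' t * ∑ k ∈ Icc (D.t₀ + D.ℓ + 1) (t - D.L + 1), runY D p k t := by
    rw [mul_sum]
    refine sum_le_sum fun k hk => ?_
    have hk' := mem_Icc.1 hk
    rcases runY_cases D p k t with hw | ⟨hw, hR⟩
    · simp [hw]
    · have h := hp.shut_later t (mem_Icc.2 (by omega)) k hk
      rw [hp.u_eq_zero (by omega) (by omega) (hR.2.2.resolve_left (by omega)),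
        hp.v_eq_one (by omega) (by omega) ⟨hR.1, hR.2.1 k le_rfl (by omega)⟩,
        sum_eq_zero fun s hs => by
          rw [mem_Icc] at hs
          rw [hR.2.1 s (by omega) (by omega), sub_self]] at h
      rw [hw]; linarith
  -- At most one on-run ends at `t`, so bounding each term by `ζ'` times its indicator charges `ζ'`
  -- at most once.
  have h3 : p.ζ' t * (runW D p t + ∑ k ∈ Icc (D.t₀ + D.ℓ + 1) (t - D.L + 1), runY D p k t)
      ≤ p.ζ' t := by
    rw [hp.runW_add_sum_runY hL hℓ hdown hup ht]
    split_ifs <;> simp [hζ]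
  simp only [shutCost, toEUC]
  linarith

theorem startCost_toEUC_le (hp : UCFeasible D p) (hℓ : 1 ≤ D.ℓ)
    (hdown : D.t₀ + D.ℓ ≤ D.T ∨ D.T ≤ D.t₀ + 1) {t : ℤ}
    (ht : t ∈ Icc (D.t₀ + D.ℓ + 1) D.T) : startCost D (toEUC D p) t ≤ p.ζ t := by
  classical
  have h0 := t₀_nonneg D
  have ht' := mem_Icc.1 ht
  have hζ := hp.ζ_nonneg t ht
  calc startCost D (toEUC D p) t
      ≤ p.ζ t * ∑ k ∈ Icc D.t₀ (t - D.ℓ - 1), runZ p k t := by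
        rw [startCost, mul_sum]
        refine sum_le_sum fun k hk => ?_
        have hk' := mem_Icc.1 hk
        simp only [toEUC]
        rcases runZ_cases p k t with hw | ⟨hw, hR⟩
        · simp [hw]
        · have h := hp.start t ht k hk
          rw [hp.v_eq_one (by omega) (by omega) ⟨hR.2.1 (t - 1) (by omega) (by omega), hR.2.2⟩,
            sum_eq_zero fun s hs => by
              rw [mem_Icc] at hs
              exact hp.u_eq_zero (by omega) (by omega) (hR.2.1 s (by omega) (by omega))] at h
          rw [hw]; linarith
    _ ≤ p.ζ t := by
        rw [hp.sum_runZ_left hℓ hdown ht]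
        split_ifs <;> simp [hζ]

theorem EUCObj_toEUC_le (hp : UCFeasible D p) (hL : 1 ≤ D.L) (hℓ : 1 ≤ D.ℓ)
    (hdown : D.t₀ + D.ℓ ≤ D.T ∨ D.T ≤ D.t₀ + 1)
    (hup : D.t₀ + D.ℓ + D.L ≤ D.T ∨ D.T ≤ D.t₀ + D.ℓ + 1) (hT : D.t₀ ≤ D.T) :
    EUCObj D (toEUC D p) ≤ UCObj D p := by
  rw [EUCObj_eq hL hℓ, UCObj]
  exact add_le_add (add_le_add
    (sum_le_sum fun s hs => (hp.sum_φ_toEUC hL hℓ hdown hup hT hs).le)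
    (sum_le_sum fun t ht => hp.startCost_toEUC_le hℓ hdown ht))
    (sum_le_sum fun t ht => hp.shutCost_toEUC_le hL hℓ hdown hup ht)

end UCFeasible

end UnitCommitment

end

theorem proposition2 (D : UnitCommitment.Data)
    (hL : 1 ≤ D.L) (hℓ : 1 ≤ D.ℓ) (hN : 1 ≤ D.N)
    (hC : 0 ≤ D.Cmin) (hV : 0 ≤ D.V) (hVbar : 0 ≤ D.Vbar)
    (hS : ∀ n, D.ℓ ≤ n → 0 ≤ D.S n) (hS' : ∀ n, D.L ≤ n → 0 ≤ D.S' n)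
    (hSmono : ∀ m n, D.ℓ ≤ m → m ≤ n → D.S m ≤ D.S n)
    (hdown : D.t₀ + D.ℓ ≤ D.T ∨ D.T ≤ D.t₀ + 1)
    (hup : D.t₀ + D.ℓ + D.L ≤ D.T ∨ D.T ≤ D.t₀ + D.ℓ + 1)
    (e : UnitCommitment.EUCVars)
    (hopt : UnitCommitment.EUCOptimal D e) (hint : UnitCommitment.EUCIntegral D e) :
    ∃ p : UnitCommitment.UCVars, UnitCommitment.UCOptimal D p ∧
      ∀ s ∈ Finset.Icc 1 D.T,
        p.x s = UnitCommitment.xOf D e s ∧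
        p.u s = UnitCommitment.uOf D e s ∧
        p.v s = UnitCommitment.vOf D e s := by
  obtain ⟨he, hmin⟩ := hopt
  -- Otherwise the sum of the `w` is empty and cannot equal one.
  have hT : D.t₀ ≤ D.T := by
    by_contra h
    have := he.sum_w
    rw [Finset.Icc_eq_empty h, Finset.sum_empty] at this
    norm_num at this
  refine ⟨UnitCommitment.toUC D e,
    ⟨UnitCommitment.toUC_feasible he hint hL hℓ hC hV hVbar hS hS' hSmono, fun p hp => ?_⟩,
    fun s hs => ⟨?_, UnitCommitment.onFlow_eq_uOf (Finset.mem_Icc.1 hs).1, rfl⟩⟩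
  · exact (UnitCommitment.UCObj_toUC_le he hL hℓ hN).trans
      ((hmin _ (hp.toEUC_feasible hL hℓ hdown hup hT)).trans
        (hp.EUCObj_toEUC_le hL hℓ hdown hup hT))
  · simp only [UnitCommitment.toUC, max_eq_left (Finset.mem_Icc.1 hs).1]
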